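/- Let $n\ge 1$. For a measurable $g$ on $\mathbb{R}^n$ (with values in $\mathbb{C}$ or in $[0,\infty]$) put, for $t>0$, $$g^*(t)=\inf\{y>0:\ |\{x:|g(x)|>y\}|\le t\},\qquad g^{**}(t)=\frac1t\int_0^t g^*(\tau)\,d\tau .$$ Let $E=E(\mathbb{R}^n)$ be a rearrangement-invariant space: $E$ consists of the Lebesgue measurable $f:\mathbb{R}^n\to\mathbb{C}$ with $\|f\|_E=\rho(|f|)<\infty$, where $\rho$ maps the measurable functions $\mathbb{R}^n\to[0,\infty]$ to $[0,\infty]$ and satisfies: (P1) $\rho(f)=0\iff f=0$ a.e., $\rho(\alpha f)=\alpha\rho(f)$ for $\alpha\ge0$, $\rho(f+g)\le\rho(f)+\rho(g)$; (P2) $f\le g$ a.e. implies $\rho(f)\le\rho(g)$; (P3) $f_k\uparrow f$ a.e. implies $\rho(f_k)\to\rho(f)$; (P4) if $0<|\sigma|<\infty$, there is $c_\sigma<\infty$ with $\int_\sigma f\le c_\sigma\rho(f)$ for all $f$; (P5) if $0<|\sigma|<\infty$, then $\rho(\chi_\sigma)<\infty$; and $f^*\le g^*$ implies $\rho(f)\le\rho(g)$.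 Let $\Phi\in B_n(\infty)$, i.e. $\Phi:(0,\infty)\to(0,\infty)$ is non-increasing and continuous, and there is $C>0$ with $\int_0^r\Phi(s)s^{n-1}\,ds\le C\,\Phi(r)r^n$ for all $r>0$. Put $$(M_\Phi f)(x)=\sup_{r>0}\Phi(r)\int_{B(x,r)}|f(y)|\,dy\in[0,\infty],$$ $$M_E^\Phi=\{M_\Phi f: f\in E\},\qquad \|u\|_{M_E^\Phi}=\inf\{\|f\|_E: f\in E,\ M_\Phi f=u\}.$$ Consider the following sets of functions $h:(0,\infty)\to[0,\infty]$, with functionals: * $K_1=\{u^*: u\in M_E^\Phi\}$, $\ \rho_{K_1}(h)=\inf\{\|u\|_{M_E^\Phi}: u\in M_E^\Phi,\ u^*=h\}$; * $K_2=\{u^{**}: u\in M_E^\Phi\}$, $\ \rho_{K_2}(h)=\inf\{\|u\|_{M_E^\Phi}: u\in M_E^\Phi,\ u^{**}=h\}$; * $K_3=\{S_u: u\in E\}$, $\ \rho_{K_3}(h)=\inf\{\|u\|_E: u\in E,\ S_u=h\}$, where $S_u(t)=\sup_{\tau>t}\tau\Phi(\tau^{1/n})u^{**}(\tau)$. For two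 such sets write $M\prec K$ ($K$ covers $M$) if there is $C_0\in(0,\infty)$ such that for every $h_1\in M$ there is $h_2\in K$ with $\rho_K(h_2)\le C_0\,\rho_M(h_1)$ and $h_1(t)\le h_2(t)$ for all $t>0$; write $M\approx K$ if $M\prec K$ and $K\prec M$. **Theorem 3.5.** The sets $K_1,K_2,K_3$ are mutually covering: $$K_1\approx K_2\approx K_3\qquad(\text{and } K_1\approx K_3).$$ Moreover, if $S_u(t)<\infty$ for all $u\in E$ and $t>0$, then each $K=K_i$ is a cone of finite-valued measurable functions $h:(0,\infty)\to[0,\infty)$, and its functional is finite and satisfies $\alpha h\in K$ and $\rho_K(\alpha h)=\alpha\rho_K(h)$ for $h\in K$, $\alpha\ge0$, and $\rho_K(h)=0\Rightarrow h=0$ a.e. -/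

import Mathlib

open MeasureTheory Set Filter Topology
open scoped ENNReal NNReal

noncomputable section

/-- The space `ℝⁿ` with the Euclidean norm and Lebesgue measure. -/
abbrev Rn (n : ℕ) : Type := EuclideanSpace ℝ (Fin n)

/-- The half-line `(0, ∞)`. -/
abbrev RPos : Type := Set.Ioi (0 : ℝ)

/-- The distribution function `λ_g(y) = |{x : g x > y}|` of a `[0,∞]`-valued function. -/
def distribFn {n : ℕ} (g : Rn n → ℝ≥0∞) (y : ℝ≥0∞) : ℝ≥0∞ :=
  volume {x : Rn n | y < g x}

/-- The non-increasing rearrangement `g*(t) = inf {y > 0 : λ_g(y) ≤ t}`, used for `t > 0`. -/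
def rearr {n : ℕ} (g : Rn n → ℝ≥0∞) (t : ℝ) : ℝ≥0∞ :=
  sInf {y : ℝ≥0∞ | 0 < y ∧ distribFn g y ≤ ENNReal.ofReal t}

/-- The maximal function of the rearrangement, `g**(t) = (1/t) ∫₀ᵗ g*(τ) dτ`, used for `t > 0`. -/
def rearrAvg {n : ℕ} (g : Rn n → ℝ≥0∞) (t : ℝ) : ℝ≥0∞ :=
  (ENNReal.ofReal t)⁻¹ * ∫⁻ τ in Set.Ioc 0 t, rearr g τ

/-- The absolute value of a complex function, as a `[0,∞]`-valued function. -/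
def absFn {n : ℕ} (f : Rn n → ℂ) : Rn n → ℝ≥0∞ := fun x => ‖f x‖ₑ

/-- Rearrangement-invariant functional norms on `ℝⁿ`: a Banach function norm in the sense of
Bennett and Sharpley (axioms P1 to P5, on Lebesgue measurable functions with values in `[0,∞]`)
that is monotone with respect to the non-increasing rearrangement. -/
structure IsRINorm {n : ℕ} (ρ : (Rn n → ℝ≥0∞) → ℝ≥0∞) : Prop where
  eq_zero_iff : ∀ f, AEMeasurable f volume → (ρ f = 0 ↔ f =ᵐ[volume] 0)
  smul : ∀ (c : ℝ≥0) (f), AEMeasurable f volume → ρ (fun x => (c : ℝ≥0∞) * f x) = c * ρ f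
  add_le : ∀ f g, AEMeasurable f volume → AEMeasurable g volume →
    ρ (fun x => f x + g x) ≤ ρ f + ρ g
  mono : ∀ f g, AEMeasurable f volume → AEMeasurable g volume → f ≤ᵐ[volume] g → ρ f ≤ ρ g
  fatou : ∀ (f : ℕ → Rn n → ℝ≥0∞) (g : Rn n → ℝ≥0∞),
    (∀ k, AEMeasurable (f k) volume) → AEMeasurable g volume →
    (∀ k, f k ≤ᵐ[volume] f (k + 1)) →
    (∀ᵐ x ∂volume, Tendsto (fun k => f k x) atTop (𝓝 (g x))) →
    Tendsto (fun k => ρ (f k)) atTop (𝓝 (ρ g))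
  local_integrability : ∀ σ : Set (Rn n), MeasurableSet σ → 0 < volume σ → volume σ < ∞ →
    ∃ c : ℝ≥0, ∀ f, AEMeasurable f volume → ∫⁻ x in σ, f x ≤ c * ρ f
  indicator_lt_top : ∀ σ : Set (Rn n), MeasurableSet σ → 0 < volume σ → volume σ < ∞ →
    ρ (σ.indicator fun _ => 1) < ∞
  rearr_mono : ∀ f g, AEMeasurable f volume → AEMeasurable g volume →
    (∀ t : ℝ, 0 < t → rearr f t ≤ rearr g t) → ρ f ≤ ρ g

/-- The norm `‖f‖_E = ρ(|f|)` of the space `E = E(ρ)`. -/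
def normE {n : ℕ} (ρ : (Rn n → ℝ≥0∞) → ℝ≥0∞) (f : Rn n → ℂ) : ℝ≥0∞ := ρ (absFn f)

/-- The space `E = E(ρ)`: the Lebesgue measurable functions `f : ℝⁿ → ℂ` with `ρ(|f|) < ∞`. -/
def spaceE {n : ℕ} (ρ : (Rn n → ℝ≥0∞) → ℝ≥0∞) : Set (Rn n → ℂ) :=
  {f | AEMeasurable f volume ∧ normE ρ f < ∞}

/-- The class `B_n(∞)`: positive, non-increasing, continuous functions `Φ` on `(0, ∞)` such that
`∫₀ʳ Φ(s) s^(n-1) ds ≤ C Φ(r) rⁿ` for all `r > 0`. -/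
structure ClassB (n : ℕ) (Φ : ℝ → ℝ) : Prop where
  pos : ∀ r, 0 < r → 0 < Φ r
  antitone : AntitoneOn Φ (Set.Ioi 0)
  continuous : ContinuousOn Φ (Set.Ioi 0)
  integral_le : ∃ C : ℝ, 0 < C ∧ ∀ r, 0 < r →
    ∫⁻ s in Set.Ioc 0 r, ENNReal.ofReal (Φ s * s ^ (n - 1)) ≤ ENNReal.ofReal (C * Φ r * r ^ n)

/-- The generalized fractional maximal function
`(M_Φ f)(x) = sup_{r > 0} Φ(r) ∫_{B(x,r)} |f(y)| dy`. -/
def maximalFn {n : ℕ} (Φ : ℝ → ℝ) (f : Rn n → ℂ) (x : Rn n) : ℝ≥0∞ :=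
  ⨆ (r : ℝ) (_ : 0 < r), ENNReal.ofReal (Φ r) * ∫⁻ y in Metric.ball x r, absFn f y

/-- The space `M_E^Φ` of generalized fractional maximal functions. -/
def spaceM {n : ℕ} (ρ : (Rn n → ℝ≥0∞) → ℝ≥0∞) (Φ : ℝ → ℝ) : Set (Rn n → ℝ≥0∞) :=
  {u | ∃ f ∈ spaceE ρ, u = maximalFn Φ f}

/-- The functional `‖u‖ = inf {‖f‖_E : f ∈ E, M_Φ f = u}` on `M_E^Φ`. -/
def normM {n : ℕ} (ρ : (Rn n → ℝ≥0∞) → ℝ≥0∞) (Φ : ℝ → ℝ) (u : Rn n → ℝ≥0∞) : ℝ≥0∞ :=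
  ⨅ (f : Rn n → ℂ) (_ : f ∈ spaceE ρ) (_ : maximalFn Φ f = u), normE ρ f

/-- A set of non-negative functions on `(0, ∞)` with a functional on it
(only the values of the functional on the set matter). -/
structure FnCone where
  carrier : Set (RPos → ℝ≥0∞)
  functional : (RPos → ℝ≥0∞) → ℝ≥0∞

/-- `K` belongs to the class of cones of finite measurable non-negative functions on `(0, ∞)`
with a finite, positively homogeneous functional that vanishes only on null functions. -/
structure FnCone.IsRegular (K : FnCone) : Prop where
  measurable : ∀ h ∈ K.carrier, Measurable h
  finite : ∀ h ∈ K.carrier, ∀ t, h t < ∞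
  functional_lt_top : ∀ h ∈ K.carrier, K.functional h < ∞
  smul_mem : ∀ h ∈ K.carrier, ∀ c : ℝ≥0, (fun t => (c : ℝ≥0∞) * h t) ∈ K.carrier
  functional_smul : ∀ h ∈ K.carrier, ∀ c : ℝ≥0,
    K.functional (fun t => (c : ℝ≥0∞) * h t) = c * K.functional h
  eq_zero : ∀ h ∈ K.carrier, K.functional h = 0 →
    h =ᵐ[(volume : Measure ℝ).comap Subtype.val] 0

/-- `M.CoveredBy K` is the covering relation `M ≺ K` for cones of functions on `(0, ∞)`
(the additive constant is zero on the infinite interval). -/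
def FnCone.CoveredBy (M K : FnCone) : Prop :=
  ∃ C₀ : ℝ≥0, 0 < C₀ ∧ ∀ h₁ ∈ M.carrier, ∃ h₂ ∈ K.carrier,
    K.functional h₂ ≤ C₀ * M.functional h₁ ∧ ∀ t : RPos, h₁ t ≤ h₂ t

/-- Equivalence of cones `M ≈ K`: mutual covering. -/
def FnCone.Equivalent (M K : FnCone) : Prop := M.CoveredBy K ∧ K.CoveredBy M

/-- The cone `K₁` of the rearrangements `u*`, `u ∈ M_E^Φ`. -/
def cone1 {n : ℕ} (ρ : (Rn n → ℝ≥0∞) → ℝ≥0∞) (Φ : ℝ → ℝ) : FnCone where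
  carrier := {h | ∃ u ∈ spaceM ρ Φ, ∀ t : RPos, h t = rearr u t}
  functional h := ⨅ (u : Rn n → ℝ≥0∞) (_ : u ∈ spaceM ρ Φ) (_ : ∀ t : RPos, rearr u t = h t),
    normM ρ Φ u

/-- The cone `K₂` of the maximal functions `u**`, `u ∈ M_E^Φ`. -/
def cone2 {n : ℕ} (ρ : (Rn n → ℝ≥0∞) → ℝ≥0∞) (Φ : ℝ → ℝ) : FnCone where
  carrier := {h | ∃ u ∈ spaceM ρ Φ, ∀ t : RPos, h t = rearrAvg u t}
  functional h := ⨅ (u : Rn n → ℝ≥0∞) (_ : u ∈ spaceM ρ Φ) (_ : ∀ t : RPos, rearrAvg u t = h t),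
    normM ρ Φ u

/-- `sup_{τ > t} τ Φ(τ^{1/n}) u**(τ)`. -/
def supFn {n : ℕ} (Φ : ℝ → ℝ) (u : Rn n → ℂ) (t : ℝ) : ℝ≥0∞ :=
  ⨆ (τ : ℝ) (_ : t < τ), ENNReal.ofReal (τ * Φ (τ ^ (1 / (n : ℝ)))) * rearrAvg (absFn u) τ

/-- The cone `K₃` of the functions `t ↦ sup_{τ > t} τ Φ(τ^{1/n}) u**(τ)`, `u ∈ E`. -/
def cone3 {n : ℕ} (ρ : (Rn n → ℝ≥0∞) → ℝ≥0∞) (Φ : ℝ → ℝ) : FnCone where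
  carrier := {h | ∃ u ∈ spaceE ρ, ∀ t : RPos, h t = supFn Φ u t}
  functional h := ⨅ (u : Rn n → ℂ) (_ : u ∈ spaceE ρ) (_ : ∀ t : RPos, supFn Φ u t = h t),
    normE ρ u

end

/-! Write M for `maximalFn Φ`. All three cones are images of E under monotone, positively
homogeneous operators, f ↦ (Mf)*, (Mf)** and S_f, with the quotient functional. Everything rests on
the pointwise chain (Mf)* ≤ (Mf)** ≤ C S_f and on S_f ≤ C' (Mg)*, where g is the radial decreasing
rearrangement of |f|, so that ‖g‖ ≤ ‖f‖.

Upper bound: with R = t^{1/n}, balls of radius above R are controlled by S_f(t) through the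
Hardy–Littlewood inequality. For smaller balls |f| is cut at height f*(t): the low part contributes
a multiple of Φ(R) t f*(t), and the high part, of mass at most ∫₀ᵗ f*, obeys a Vitali weak-type
bound. This gives (Mf)* ≤ C S_f; the condition B_n(∞) makes the bound survive averaging over (0,t).
Lower bound: Mg is at least Φ(2r) ∫_{B(0,r)} g on all of B(0,r), and this integral is ∫₀^τ f* when
|B(0,r)| = τ.

Pointwise bounds do not give covering at once, since the infimum in the functional need not be
attained. If it is positive, a minimizer up to a factor 2 suffices. If it vanishes at a nonzero
element, summing multiples of near-minimizers yields elements of arbitrarily small norm whose image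
is identically ∞ (`IsPositiveOperator.exists_eq_top`). The same fact makes the functional definite
when S_u is finite. -/

/-! ### Distribution functions and rearrangements -/

lemma rearr_antitone {n : ℕ} (g : Rn n → ℝ≥0∞) : Antitone (rearr g) := fun _ _ h =>
  sInf_le_sInf fun _ hy => ⟨hy.1, hy.2.trans (ENNReal.ofReal_le_ofReal h)⟩

lemma rearr_mono_fun {n : ℕ} {g g' : Rn n → ℝ≥0∞} (h : ∀ y, distribFn g y ≤ distribFn g' y)
    (t : ℝ) : rearr g t ≤ rearr g' t :=
  sInf_le_sInf fun y hy => ⟨hy.1, (h y).trans hy.2⟩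

lemma distribFn_mono {n : ℕ} {g g' : Rn n → ℝ≥0∞} (h : g ≤ᵐ[volume] g') (y : ℝ≥0∞) :
    distribFn g y ≤ distribFn g' y :=
  measure_mono_ae <| by filter_upwards [h] with x hx hy using lt_of_lt_of_le hy hx

lemma distribFn_anti {n : ℕ} (g : Rn n → ℝ≥0∞) : Antitone (distribFn g) := fun _ _ h =>
  measure_mono fun _ hx => lt_of_le_of_lt h hx

lemma rearr_le_of_distribFn_le {n : ℕ} {g : Rn n → ℝ≥0∞} {t : ℝ} {y : ℝ≥0∞} (hy : 0 < y)
    (h : distribFn g y ≤ ENNReal.ofReal t) : rearr g t ≤ y :=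
  sInf_le ⟨hy, h⟩

lemma le_rearr {n : ℕ} {g : Rn n → ℝ≥0∞} {t : ℝ} {A : Set (Rn n)} {L : ℝ≥0∞}
    (hA : ENNReal.ofReal t < volume A) (hL : ∀ x ∈ A, L ≤ g x) : L ≤ rearr g t := by
  refine le_sInf fun y hy => ?_
  by_contra! hlt
  exact absurd ((measure_mono fun x hx => lt_of_lt_of_le hlt (hL x hx)).trans hy.2) hA.not_ge

lemma le_rearr_of_lt_distribFn {n : ℕ} {g : Rn n → ℝ≥0∞} {t : ℝ} {y : ℝ≥0∞}
    (h : ENNReal.ofReal t < distribFn g y) : y ≤ rearr g t :=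
  le_rearr h fun _ hx => le_of_lt hx

/-- Testing only levels strictly above L respects the condition 0 < y in the infimum even when L =
0. -/
lemma rearr_le {n : ℕ} {g : Rn n → ℝ≥0∞} {t : ℝ} {L : ℝ≥0∞}
    (h : ∀ y, L < y → y < ∞ → distribFn g y ≤ ENNReal.ofReal t) : rearr g t ≤ L := by
  refine le_of_forall_gt fun z hz => ?_
  obtain ⟨y, hy, hyz⟩ := exists_between hz
  exact (rearr_le_of_distribFn_le (bot_le.trans_lt hy) (h y hy (hyz.trans_le le_top))).trans_lt hyz

/-- Continuity of measure from below along levels decreasing to the infimum; no measurability of g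
is needed, and t = 0 is allowed. -/
lemma distribFn_rearr_le {n : ℕ} (g : Rn n → ℝ≥0∞) (t : ℝ) :
    distribFn g (rearr g t) ≤ ENNReal.ofReal t := by
  obtain ⟨u, hu, hlim, hmem⟩ := exists_seq_tendsto_sInf
    (S := {y : ℝ≥0∞ | 0 < y ∧ distribFn g y ≤ ENNReal.ofReal t})
    ⟨∞, ENNReal.coe_lt_top, by simp [distribFn]⟩ (OrderBot.bddBelow _)
  have : {x : Rn n | rearr g t < g x} ⊆ ⋃ k, {x | u k < g x} := fun x hx => by
    obtain ⟨k, hk⟩ := (hlim.eventually (eventually_lt_nhds hx)).exists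
    exact mem_iUnion.2 ⟨k, hk⟩
  refine (measure_mono this).trans ?_
  have hmono : Monotone fun k => {x | u k < g x} := fun i j hij x hx =>
    lt_of_le_of_lt (hu hij) hx
  rw [hmono.measure_iUnion]
  exact iSup_le fun k => (hmem k).2

lemma lt_distribFn_of_lt_rearr {n : ℕ} {g : Rn n → ℝ≥0∞} {t : ℝ} {y : ℝ≥0∞}
    (h : y < rearr g t) : ENNReal.ofReal t < distribFn g y := by
  by_contra! hle
  obtain ⟨z, hz, hzt⟩ := exists_between h
  exact absurd (rearr_le_of_distribFn_le (bot_le.trans_lt hz)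
    ((distribFn_anti g hz.le).trans hle)) hzt.not_ge

lemma rearr_const_mul {n : ℕ} (c : ℝ≥0) (g : Rn n → ℝ≥0∞) (t : ℝ) :
    rearr (fun x => c * g x) t = c * rearr g t := by
  rcases eq_or_ne c 0 with rfl | hc
  · simp only [ENNReal.coe_zero, zero_mul]
    exact le_antisymm (rearr_le fun y _ _ => by simp [distribFn]) bot_le
  have hc0 : (c : ℝ≥0∞) ≠ 0 := by simpa using hc
  have hct : (c : ℝ≥0∞) ≠ ∞ := ENNReal.coe_ne_top
  have key : ∀ (c : ℝ≥0∞), c ≠ 0 → c ≠ ∞ → ∀ g : Rn n → ℝ≥0∞,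
      rearr (fun x => c * g x) t ≤ c * rearr g t := fun c hc0 hct g => by
    refine rearr_le fun y hy _ => ?_
    have : distribFn (fun x => c * g x) y = distribFn g (c⁻¹ * y) := by
      unfold distribFn
      congr 1
      ext x
      simp only [mem_ofPred_eq]
      rw [mul_comm c⁻¹ y, ← div_eq_mul_inv, ENNReal.div_lt_iff (.inl hc0) (.inl hct), mul_comm c]
    rw [this]
    refine (distribFn_anti g ?_).trans (distribFn_rearr_le g t)
    rw [mul_comm, ← div_eq_mul_inv]
    exact ENNReal.le_div_iff_mul_le (.inl hc0) (.inl hct) |>.2 (by rw [mul_comm]; exact hy.le)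
  refine le_antisymm (key c hc0 hct g) ?_
  -- The reverse inequality is `key` for the factor c⁻¹ and the function c g.
  have h2 := key (c : ℝ≥0∞)⁻¹ (by simp) (by simpa using hc) fun x => c * g x
  simp only [← mul_assoc, ENNReal.inv_mul_cancel hc0 hct, one_mul] at h2
  calc (c : ℝ≥0∞) * rearr g t ≤ c * ((c : ℝ≥0∞)⁻¹ * rearr (fun x => c * g x) t) := by gcongr
    _ = _ := by rw [← mul_assoc, ENNReal.mul_inv_cancel hc0 hct, one_mul]

/-! ### Integrals of rearrangements and the Hardy–Littlewood inequality -/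

/-- The primitive `∫₀ᵗ g*` of the rearrangement. -/
noncomputable def rearrInt {n : ℕ} (g : Rn n → ℝ≥0∞) (t : ℝ) : ℝ≥0∞ :=
  ∫⁻ τ in Ioc 0 t, rearr g τ

lemma rearrInt_mono {n : ℕ} (g : Rn n → ℝ≥0∞) : Monotone (rearrInt g) := fun _ _ h =>
  lintegral_mono_set (Ioc_subset_Ioc_right h)

lemma mul_rearr_le_rearrInt {n : ℕ} (g : Rn n → ℝ≥0∞) (t : ℝ) :
    ENNReal.ofReal t * rearr g t ≤ rearrInt g t := by
  calc ENNReal.ofReal t * rearr g t = ∫⁻ _ in Ioc 0 t, rearr g t := by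
        rw [setLIntegral_const, Real.volume_Ioc, sub_zero, mul_comm]
    _ ≤ _ := setLIntegral_mono (rearr_antitone g).measurable fun s hs => rearr_antitone g hs.2

lemma rearr_le_rearrAvg {n : ℕ} (g : Rn n → ℝ≥0∞) {t : ℝ} (ht : 0 < t) :
    rearr g t ≤ rearrAvg g t := by
  have h0 : ENNReal.ofReal t ≠ 0 := by simpa using ht
  calc rearr g t = (ENNReal.ofReal t)⁻¹ * (ENNReal.ofReal t * rearr g t) := by
        rw [← mul_assoc, ENNReal.inv_mul_cancel h0 ENNReal.ofReal_ne_top, one_mul]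
    _ ≤ _ := mul_le_mul_right (mul_rearr_le_rearrInt g t) _

lemma rearrAvg_mono_fun {n : ℕ} {g g' : Rn n → ℝ≥0∞} (h : ∀ y, distribFn g y ≤ distribFn g' y)
    (t : ℝ) : rearrAvg g t ≤ rearrAvg g' t :=
  mul_le_mul_right (lintegral_mono fun s => rearr_mono_fun h s) _

lemma rearrAvg_const_mul {n : ℕ} (c : ℝ≥0) (g : Rn n → ℝ≥0∞) (t : ℝ) :
    rearrAvg (fun x => c * g x) t = c * rearrAvg g t := by
  simp only [rearrAvg, rearr_const_mul]
  rw [lintegral_const_mul' _ _ ENNReal.coe_ne_top]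
  ring

lemma measurable_rearrAvg {n : ℕ} (g : Rn n → ℝ≥0∞) : Measurable (rearrAvg g) :=
  (ENNReal.measurable_ofReal.inv).mul (rearrInt_mono g).measurable

/-- The Hardy–Littlewood inequality `∫_A |f| ≤ ∫₀ᵃ f*` for `|A| ≤ a`. -/
lemma setLIntegral_absFn_le_rearrInt {n : ℕ} {f : Rn n → ℂ} (hf : AEMeasurable f volume)
    {A : Set (Rn n)} {a : ℝ} (ha : volume A ≤ ENNReal.ofReal a) :
    ∫⁻ x in A, absFn f x ≤ rearrInt (absFn f) a := by
  by_cases htop : rearrInt (absFn f) a = ∞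
  · simp [htop]
  have hm : Measurable (rearr (absFn f)) := (rearr_antitone _).measurable
  have hfin : ∀ᵐ s ∂volume.restrict (Ioc 0 a), rearr (absFn f) s < ∞ := ae_lt_top hm htop
  -- Layer-cake on both sides reduces the claim to one level y: |A ∩ {|f| > y}| ≤ min(a, λ(y)),
  -- while f* ≥ y on all s ≤ a with s < λ(y).
  have hL : ∫⁻ x in A, absFn f x
      = ∫⁻ y in Ioi 0, volume.restrict A {x | y < ‖f x‖} := by
    rw [← lintegral_eq_lintegral_meas_lt _ (.of_forall fun x => norm_nonneg _)
      hf.norm.restrict]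
    simp [absFn]
  have hR : rearrInt (absFn f) a
      = ∫⁻ y in Ioi 0, volume.restrict (Ioc 0 a) {s | y ≤ (rearr (absFn f) s).toReal} := by
    rw [← lintegral_eq_lintegral_meas_le _ (.of_forall fun x => ENNReal.toReal_nonneg)
      hm.ennreal_toReal.aemeasurable]
    refine lintegral_congr_ae ?_
    filter_upwards [hfin] with s hs using (ENNReal.ofReal_toReal hs.ne).symm
  rw [hL, hR]
  refine lintegral_mono_ae ((ae_restrict_iff' measurableSet_Ioi).2 (.of_forall fun y hy => ?_))
  set d := distribFn (absFn f) (ENNReal.ofReal y) with hd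
  have hsub : {s | s ∈ Ioc 0 a ∧ ENNReal.ofReal s < d} ⊆ Ioc 0 a := fun s hs => hs.1
  have h1 : volume.restrict A {x | y < ‖f x‖} ≤ min (ENNReal.ofReal a) d := by
    refine le_min ((measure_mono (subset_univ _)).trans (by simpa using ha)) ?_
    refine (Measure.restrict_apply_le _ _).trans (measure_mono fun x hx => ?_)
    simp only [mem_ofPred_eq, absFn] at hx ⊢
    rw [← ofReal_norm]
    exact (ENNReal.ofReal_lt_ofReal_iff (lt_trans hy hx)).2 hx
  have h2 : min (ENNReal.ofReal a) d ≤ volume {s : ℝ | s ∈ Ioc 0 a ∧ ENNReal.ofReal s < d} := by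
    refine le_of_forall_lt fun z hz => ?_
    obtain ⟨w, hzw, hw⟩ := exists_between hz
    have hwt : w ≠ ∞ := (hw.trans_le le_top).ne
    have hw1 : w < ENNReal.ofReal a := hw.trans_le (min_le_left _ _)
    have : Ioc 0 w.toReal ⊆ {s : ℝ | s ∈ Ioc 0 a ∧ ENNReal.ofReal s < d} := fun s hs => by
      have hsw : ENNReal.ofReal s ≤ w := ENNReal.ofReal_le_of_le_toReal hs.2
      refine ⟨⟨hs.1, ?_⟩, hsw.trans_lt (hw.trans_le (min_le_right _ _))⟩
      by_contra! hlt
      exact absurd ((ENNReal.ofReal_le_ofReal hlt.le).trans hsw) hw1.not_ge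
    refine hzw.trans_le (le_trans ?_ (measure_mono this))
    rw [Real.volume_Ioc, sub_zero, ENNReal.ofReal_toReal hwt]
  refine h1.trans (h2.trans ?_)
  rw [← Measure.restrict_eq_self _ hsub]
  refine measure_mono_ae ?_
  filter_upwards [hfin] with s hs hsd
  change s ∈ Ioc 0 a ∧ ENNReal.ofReal s < d at hsd
  exact ENNReal.ofReal_le_iff_le_toReal hs.ne |>.1 (le_rearr_of_lt_distribFn hsd.2)

/-! ### Growth of Φ and a weak-type covering estimate -/

lemma volume_ball_eq {n : ℕ} (x : Rn n) {r : ℝ} (hr : 0 < r) :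
    volume (Metric.ball x r) = ENNReal.ofReal (r ^ n) * volume (Metric.ball (0 : Rn n) 1) := by
  rw [Measure.addHaar_ball_of_pos _ _ hr, finrank_euclideanSpace_fin]

/-- The quasi-monotonicity of `Φ(r) rⁿ`. -/
lemma ClassB.exists_mul_pow_le {n : ℕ} {Φ : ℝ → ℝ} (hΦ : ClassB n Φ) (hn : 0 < n) :
    ∃ D : ℝ, 0 < D ∧ ∀ r R, 0 < r → r ≤ R → Φ r * r ^ n ≤ D * (Φ R * R ^ n) := by
  obtain ⟨C, hC, hint⟩ := hΦ.integral_le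
  refine ⟨2 ^ n * C, by positivity, fun r R hr hrR => ?_⟩
  have hR : 0 < R := hr.trans_le hrR
  have hΦr := hΦ.pos r hr
  have hΦR := hΦ.pos R hR
  -- The shell (r/2, r] suffices: on it Φ(s) ≥ Φ(r) and s ≥ r/2, whence the factor 2ⁿ in D.
  have hsub : Ioc (r / 2) r ⊆ Ioc 0 R := Ioc_subset_Ioc (by positivity) hrR
  have h1 : ENNReal.ofReal (Φ r * (r / 2) ^ n) ≤ ENNReal.ofReal (C * Φ R * R ^ n) := by
    refine le_trans ?_ ((lintegral_mono_set hsub).trans (hint R hR))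
    calc ENNReal.ofReal (Φ r * (r / 2) ^ n)
        = ∫⁻ _ in Ioc (r / 2) r, ENNReal.ofReal (Φ r * (r / 2) ^ (n - 1)) := by
          rw [setLIntegral_const, Real.volume_Ioc, ← ENNReal.ofReal_mul (by positivity)]
          congr 1
          rw [show r - r / 2 = r / 2 by ring, mul_assoc, ← pow_succ, Nat.sub_add_cancel hn]
      _ ≤ _ := by
          refine setLIntegral_mono' measurableSet_Ioc fun s hs => ENNReal.ofReal_le_ofReal ?_
          have hs0 : 0 < s := lt_trans (by positivity) hs.1
          exact mul_le_mul (hΦ.antitone hs0 hr hs.2) (pow_le_pow_left₀ (by positivity) hs.1.le _)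
            (by positivity) (hΦ.pos s hs0).le
  have h2 := (ENNReal.ofReal_le_ofReal_iff (by positivity)).1 h1
  rw [div_pow] at h2
  calc Φ r * r ^ n = 2 ^ n * (Φ r * (r ^ n / 2 ^ n)) := by field_simp
    _ ≤ 2 ^ n * (C * Φ R * R ^ n) := by gcongr
    _ = _ := by ring

/-- The substitution s = uⁿ turns the B_n(∞) condition into an averaging bound in the volume
variable. -/
lemma ClassB.exists_lintegral_rpow_le {n : ℕ} {Φ : ℝ → ℝ} (hΦ : ClassB n Φ) (hn : 0 < n) :
    ∃ A : ℝ, 0 < A ∧ ∀ t, 0 < t → ∫⁻ s in Ioc 0 t, ENNReal.ofReal (Φ (s ^ (1 / (n : ℝ))))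
      ≤ ENNReal.ofReal (A * (t * Φ (t ^ (1 / (n : ℝ))))) := by
  obtain ⟨C, hC, hint⟩ := hΦ.integral_le
  have hn' : (n : ℝ) ≠ 0 := by positivity
  refine ⟨n * C, by positivity, fun t ht => ?_⟩
  set r := t ^ (1 / (n : ℝ)) with hr
  have hr0 : 0 < r := by positivity
  have hrn : r ^ n = t := by
    rw [hr, one_div, Real.rpow_inv_natCast_pow ht.le hn.ne']
  have himg : (fun s : ℝ => s ^ n) '' Ioc 0 r = Ioc 0 t := by
    ext s
    constructor
    · rintro ⟨u, hu, rfl⟩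
      exact ⟨pow_pos hu.1 n, hrn ▸ pow_le_pow_left₀ hu.1.le hu.2 n⟩
    · intro hs
      refine ⟨s ^ (1 / (n : ℝ)), ⟨Real.rpow_pos_of_pos hs.1 _, ?_⟩, ?_⟩
      · exact Real.rpow_le_rpow hs.1.le hs.2 (by positivity)
      · simp only [one_div]
        rw [Real.rpow_inv_natCast_pow hs.1.le hn.ne']
  rw [← himg, lintegral_image_eq_lintegral_abs_deriv_mul measurableSet_Ioc
    (f' := fun s => n * s ^ (n - 1)) (fun x _ => (hasDerivAt_pow n x).hasDerivWithinAt)]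
  · calc ∫⁻ s in Ioc 0 r, ENNReal.ofReal |n * s ^ (n - 1)|
          * ENNReal.ofReal (Φ ((s ^ n) ^ (1 / (n : ℝ))))
        = ∫⁻ s in Ioc 0 r, n * ENNReal.ofReal (Φ s * s ^ (n - 1)) := by
          refine setLIntegral_congr_fun measurableSet_Ioc fun s hs => ?_
          have hs0 := hs.1
          have hΦs := hΦ.pos s hs0
          simp only [one_div]
          rw [Real.pow_rpow_inv_natCast hs0.le hn.ne', abs_of_nonneg (by positivity),
            ← ENNReal.ofReal_natCast, ← ENNReal.ofReal_mul (by positivity),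
            ← ENNReal.ofReal_mul (by positivity)]
          congr 1
          ring
      _ = n * ∫⁻ s in Ioc 0 r, ENNReal.ofReal (Φ s * s ^ (n - 1)) :=
          lintegral_const_mul' _ _ (by simp)
      _ ≤ n * ENNReal.ofReal (C * Φ r * r ^ n) := by gcongr; exact hint r hr0
      _ = _ := by
          rw [← ENNReal.ofReal_natCast, ← ENNReal.ofReal_mul (by positivity), hrn]
          congr 1
          ring
  · intro a ha b hb hab
    exact (pow_left_inj₀ ha.1.le hb.1.le hn.ne').1 hab

/-- A weak-type estimate for the maximal function of a measure over balls of bounded radius. -/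
lemma mul_volume_setOf_exists_ball_le {n : ℕ} {Φ : ℝ → ℝ} {D : ℝ}
    (hD : ∀ r R, 0 < r → r ≤ R → Φ r * r ^ n ≤ D * (Φ R * R ^ n)) (ν : Measure (Rn n))
    (R : ℝ) (y : ℝ≥0∞) :
    y * volume {x : Rn n | ∃ r, 0 < r ∧ r ≤ R ∧ y < ENNReal.ofReal (Φ r) * ν (Metric.ball x r)}
      ≤ ENNReal.ofReal (4 ^ n * (D * (Φ R * R ^ n))) * volume (Metric.ball (0 : Rn n) 1)
        * ν univ := by
  set A := {x : Rn n | ∃ r, 0 < r ∧ r ≤ R ∧ y < ENNReal.ofReal (Φ r) * ν (Metric.ball x r)}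
    with hA
  have hex : ∀ x : Rn n, ∃ r, x ∈ A →
      0 < r ∧ r ≤ R ∧ y < ENNReal.ofReal (Φ r) * ν (Metric.ball x r) := fun x => by
    by_cases hx : x ∈ A
    · obtain ⟨r, hr⟩ := hx
      exact ⟨r, fun _ => hr⟩
    · exact ⟨0, fun h => absurd h hx⟩
  choose r hr using hex
  -- Vitali needs an enlargement factor above 3; the choice 4 produces the constant 4ⁿ.
  obtain ⟨u, huA, hdisj, hcov⟩ := Vitali.exists_disjoint_subfamily_covering_enlargement_closedBall
    A (fun x => x) r R (fun x hx => (hr x hx).2.1) 4 (by norm_num)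
  have hu : u.Countable := hdisj.countable_of_nonempty_interior fun x hx =>
    ⟨x, interior_mono Metric.ball_subset_closedBall
      (by rw [Metric.isOpen_ball.interior_eq]; exact Metric.mem_ball_self (hr x (huA hx)).1)⟩
  have hsub : A ⊆ ⋃ x ∈ u, Metric.closedBall x (4 * r x) := fun x hx => by
    obtain ⟨b, hb, hbx⟩ := hcov x hx
    exact mem_biUnion hb (hbx (Metric.mem_closedBall_self (hr x hx).1.le))
  have := hu.to_subtype
  set K := ENNReal.ofReal (4 ^ n * (D * (Φ R * R ^ n))) * volume (Metric.ball (0 : Rn n) 1)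
    with hK
  -- Quasi-monotonicity replaces Φ(r) rⁿ by its value at R, making the constant independent of the
  -- ball.
  have hterm : ∀ x : u, y * volume (Metric.closedBall (x : Rn n) (4 * r x))
      ≤ K * ν (Metric.ball (x : Rn n) (r x)) := fun x => by
    obtain ⟨h0, h1, h2⟩ := hr x (huA x.2)
    have h4 : 0 < 4 * r x := by positivity
    have hpow : (0 : ℝ) ≤ 4 ^ n * r x ^ n := by positivity
    rw [Measure.addHaar_closedBall _ _ h4.le, finrank_euclideanSpace_fin]
    calc y * (ENNReal.ofReal ((4 * r x) ^ n) * volume (Metric.ball (0 : Rn n) 1))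
        ≤ ENNReal.ofReal (Φ (r x)) * ν (Metric.ball (x : Rn n) (r x))
          * (ENNReal.ofReal ((4 * r x) ^ n) * volume (Metric.ball (0 : Rn n) 1)) := by
          gcongr
      _ = ENNReal.ofReal (4 ^ n * (Φ (r x) * r x ^ n)) * volume (Metric.ball (0 : Rn n) 1)
          * ν (Metric.ball (x : Rn n) (r x)) := by
          rw [show (4 : ℝ) ^ n * (Φ (r x) * r x ^ n) = (4 * r x) ^ n * Φ (r x) by
            rw [mul_pow]; ring, ENNReal.ofReal_mul (by positivity)]
          ring
      _ ≤ _ := by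
          rw [hK]
          gcongr ENNReal.ofReal (4 ^ n * ?_) * _ * _
          exact hD _ _ h0 h1
  calc y * volume A ≤ y * ∑' x : u, volume (Metric.closedBall (x : Rn n) (4 * r x)) := by
        gcongr
        exact (measure_mono hsub).trans (measure_biUnion_le _ hu _)
    _ = ∑' x : u, y * volume (Metric.closedBall (x : Rn n) (4 * r x)) := ENNReal.tsum_mul_left.symm
    _ ≤ ∑' x : u, K * ν (Metric.ball (x : Rn n) (r x)) := ENNReal.tsum_le_tsum hterm
    _ = K * ∑' x : u, ν (Metric.ball (x : Rn n) (r x)) := ENNReal.tsum_mul_left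
    _ = K * ν (⋃ x ∈ u, Metric.ball x (r x)) := by
        rw [measure_biUnion hu (hdisj.mono fun _ => Metric.ball_subset_closedBall)
          fun _ _ => measurableSet_ball]
    _ ≤ K * ν univ := by gcongr; exact subset_univ _

/-! ### Radial rearrangement -/

/-- The map `x ↦ |B(0, ‖x‖)|`. -/
noncomputable def ballVolume {n : ℕ} (x : Rn n) : ℝ :=
  (volume (Metric.ball (0 : Rn n) 1)).toReal * ‖x‖ ^ n

lemma volume_unitBall_toReal_pos (n : ℕ) : 0 < (volume (Metric.ball (0 : Rn n) 1)).toReal :=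
  ENNReal.toReal_pos (Metric.measure_ball_pos _ _ one_pos).ne' measure_ball_lt_top.ne

lemma measurable_ballVolume {n : ℕ} : Measurable (ballVolume (n := n)) := by
  unfold ballVolume
  fun_prop

lemma ballVolume_preimage_Iio {n : ℕ} (hn : 0 < n) {r : ℝ} (hr : 0 < r) :
    ballVolume ⁻¹' Iio ((volume (Metric.ball (0 : Rn n) 1)).toReal * r ^ n)
      = Metric.ball (0 : Rn n) r := by
  ext x
  have := volume_unitBall_toReal_pos n
  simp only [mem_preimage, mem_Iio, ballVolume, mem_ball_zero_iff]
  rw [mul_lt_mul_iff_right₀ this, pow_lt_pow_iff_left₀ (norm_nonneg _) hr.le hn.ne']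

lemma volume_ballVolume_preimage_Iio {n : ℕ} (hn : 0 < n) (b : ℝ) :
    volume (ballVolume (n := n) ⁻¹' Iio b) = ENNReal.ofReal b := by
  have hω := volume_unitBall_toReal_pos n
  rcases le_or_gt b 0 with hb | hb
  · rw [ENNReal.ofReal_of_nonpos hb]
    convert measure_empty (μ := volume)
    ext x
    simp only [mem_preimage, mem_Iio, mem_empty_iff_false, iff_false, not_lt]
    exact hb.trans (mul_nonneg hω.le (by positivity))
  · set ω := (volume (Metric.ball (0 : Rn n) 1)).toReal with hωdef
    have hr : 0 < (b / ω) ^ (1 / (n : ℝ)) := by positivity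
    have hrn : ((b / ω) ^ (1 / (n : ℝ))) ^ n = b / ω := by
      rw [one_div, Real.rpow_inv_natCast_pow (by positivity) hn.ne']
    have h := ballVolume_preimage_Iio hn hr
    rw [← hωdef, hrn, mul_div_cancel₀ _ hω.ne'] at h
    rw [h, volume_ball_eq _ hr, hrn, ← ENNReal.ofReal_toReal
      (measure_ball_lt_top (μ := volume) (x := (0 : Rn n)) (r := 1)).ne, ← hωdef,
      ← ENNReal.ofReal_mul (by positivity), div_mul_cancel₀ _ hω.ne']

/-- Preimages of half-open intervals are shells of known volume, and such intervals determine the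
measure. This is polar integration for radial functions. -/
lemma map_ballVolume {n : ℕ} (hn : 0 < n) :
    Measure.map (ballVolume (n := n)) volume = volume.restrict (Ioi 0) := by
  have hval : ∀ ⦃a b : ℝ⦄, a < b → Measure.map (ballVolume (n := n)) volume (Ico a b)
      = ENNReal.ofReal b - ENNReal.ofReal a := fun a b hab => by
    rw [Measure.map_apply measurable_ballVolume measurableSet_Ico,
      show Ico a b = Iio b \ Iio a by ext; simp, preimage_sdiff,
      measure_sdiff (preimage_mono (Iio_subset_Iio hab.le))
        (measurable_ballVolume measurableSet_Iio).nullMeasurableSet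
        (by rw [volume_ballVolume_preimage_Iio hn]; exact ENNReal.ofReal_ne_top),
      volume_ballVolume_preimage_Iio hn, volume_ballVolume_preimage_Iio hn]
  refine Measure.ext_of_Ico' _ _ (fun a b hab => ?_) fun a b hab => ?_
  · rw [hval hab]
    exact ENNReal.sub_ne_top ENNReal.ofReal_ne_top
  · rw [hval hab, Measure.restrict_apply measurableSet_Ico]
    rcases le_or_gt a 0 with ha | ha
    · have h1 : Ioo 0 b ⊆ Ico a b ∩ Ioi 0 := fun s hs => ⟨⟨ha.trans hs.1.le, hs.2⟩, hs.1⟩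
      have h2 : Ico a b ∩ Ioi 0 ⊆ Ioo 0 b := fun s hs => ⟨hs.2, hs.1.2⟩
      rw [subset_antisymm h2 h1, Real.volume_Ioo, ENNReal.ofReal_of_nonpos ha]
      simp
    · rw [inter_eq_left.2 (show Ico a b ⊆ Ioi 0 from fun s hs => ha.trans_le hs.1), Real.volume_Ico,
        ENNReal.ofReal_sub _ ha.le]

/-- The radially symmetric non-increasing function with the same rearrangement as `g`. -/
noncomputable def radialRearr {n : ℕ} (g : Rn n → ℝ≥0∞) (x : Rn n) : ℝ≥0∞ :=
  rearr g (ballVolume x)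

lemma measurable_radialRearr {n : ℕ} (g : Rn n → ℝ≥0∞) : Measurable (radialRearr g) :=
  (rearr_antitone g).measurable.comp measurable_ballVolume

/-- If g*(s) > y then s < λ_g(y). Only this half of equimeasurability is needed to bound the norm.
-/
lemma distribFn_radialRearr_le {n : ℕ} (hn : 0 < n) (g : Rn n → ℝ≥0∞) (y : ℝ≥0∞) :
    distribFn (radialRearr g) y ≤ distribFn g y := by
  have hm : MeasurableSet {s | y < rearr g s} :=
    measurableSet_lt measurable_const (rearr_antitone g).measurable
  have h1 : distribFn (radialRearr g) y = volume ({s | y < rearr g s} ∩ Ioi 0) := by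
    rw [← Measure.restrict_apply hm, ← map_ballVolume hn,
      Measure.map_apply measurable_ballVolume hm]
    rfl
  rw [h1]
  by_cases htop : distribFn g y = ∞
  · simp [htop]
  have hsub : {s | y < rearr g s} ∩ Ioi 0 ⊆ Ioo 0 (distribFn g y).toReal := fun s hs =>
    ⟨hs.2, (ENNReal.ofReal_lt_iff_lt_toReal (le_of_lt hs.2) htop).1
      (lt_distribFn_of_lt_rearr hs.1)⟩
  refine (measure_mono hsub).trans ?_
  rw [Real.volume_Ioo, sub_zero, ENNReal.ofReal_toReal htop]

lemma setLIntegral_radialRearr {n : ℕ} (hn : 0 < n) (g : Rn n → ℝ≥0∞) {r : ℝ} (hr : 0 < r) :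
    ∫⁻ x in Metric.ball (0 : Rn n) r, radialRearr g x
      = rearrInt g ((volume (Metric.ball (0 : Rn n) 1)).toReal * r ^ n) := by
  rw [← ballVolume_preimage_Iio hn hr]
  change ∫⁻ x in _, rearr g (ballVolume x) = _
  rw [← setLIntegral_map measurableSet_Iio (rearr_antitone g).measurable measurable_ballVolume,
    map_ballVolume hn, Measure.restrict_restrict measurableSet_Iio, inter_comm, Ioi_inter_Iio,
    setLIntegral_congr Ioo_ae_eq_Ioc]
  rfl

/-! ### Elementary bounds for M_Φ f and S_f -/

lemma le_maximalFn {n : ℕ} (Φ : ℝ → ℝ) (f : Rn n → ℂ) (x : Rn n) {r : ℝ} (hr : 0 < r) :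
    ENNReal.ofReal (Φ r) * ∫⁻ y in Metric.ball x r, absFn f y ≤ maximalFn Φ f x :=
  le_iSup₂_of_le r hr le_rfl

/-- A lower bound for the rearrangement of the maximal function. -/
lemma le_rearr_maximalFn {n : ℕ} (Φ : ℝ → ℝ) (f : Rn n → ℂ) {r s t : ℝ} (hr : 0 < r)
    (hsr : s ≤ r) (ht : ENNReal.ofReal t < volume (Metric.ball (0 : Rn n) r)) :
    ENNReal.ofReal (Φ (2 * r)) * ∫⁻ y in Metric.ball 0 s, absFn f y
      ≤ rearr (maximalFn Φ f) t := by
  -- For |x| < r the ball B(x, 2r) contains B(0, r), hence B(0, s).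
  refine le_rearr ht fun x hx => le_trans ?_ (le_maximalFn Φ f x (by positivity : 0 < 2 * r))
  gcongr
  refine Metric.ball_subset_ball' ?_
  have : dist 0 x < r := by rw [dist_comm]; exact hx
  linarith

lemma rpow_one_div_pow {n : ℕ} (hn : 0 < n) {t : ℝ} (ht : 0 < t) : (t ^ (1 / (n : ℝ))) ^ n = t := by
  rw [one_div, Real.rpow_inv_natCast_pow ht.le hn.ne']

lemma pow_rpow_one_div {n : ℕ} (hn : 0 < n) {t : ℝ} (ht : 0 < t) : (t ^ n) ^ (1 / (n : ℝ)) = t := by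
  rw [one_div, Real.pow_rpow_inv_natCast ht.le hn.ne']

lemma supFn_term_eq {n : ℕ} {Φ : ℝ → ℝ} (f : Rn n → ℂ) {τ : ℝ} (hτ : 0 < τ) :
    ENNReal.ofReal (τ * Φ (τ ^ (1 / (n : ℝ)))) * rearrAvg (absFn f) τ
      = ENNReal.ofReal (Φ (τ ^ (1 / (n : ℝ)))) * rearrInt (absFn f) τ := by
  have h0 : ENNReal.ofReal τ ≠ 0 := by simpa using hτ
  rw [ENNReal.ofReal_mul hτ.le, rearrAvg, rearrInt]
  calc _ = (ENNReal.ofReal τ * (ENNReal.ofReal τ)⁻¹) * (ENNReal.ofReal (Φ (τ ^ (1 / (n : ℝ))))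
        * ∫⁻ s in Ioc 0 τ, rearr (absFn f) s) := by ring
    _ = _ := by rw [ENNReal.mul_inv_cancel h0 ENNReal.ofReal_ne_top, one_mul]

lemma le_supFn {n : ℕ} {Φ : ℝ → ℝ} (f : Rn n → ℂ) {t τ : ℝ} (ht : 0 < t) (htτ : t < τ) :
    ENNReal.ofReal (Φ (τ ^ (1 / (n : ℝ)))) * rearrInt (absFn f) τ ≤ supFn Φ f t := by
  rw [← supFn_term_eq f (ht.trans htτ)]
  exact le_iSup₂_of_le τ htτ le_rfl

lemma supFn_le {n : ℕ} {Φ : ℝ → ℝ} {f : Rn n → ℂ} {t : ℝ} {L : ℝ≥0∞} (ht : 0 < t)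
    (h : ∀ τ, t < τ → ENNReal.ofReal (Φ (τ ^ (1 / (n : ℝ)))) * rearrInt (absFn f) τ ≤ L) :
    supFn Φ f t ≤ L :=
  iSup₂_le fun τ hτ => by rw [supFn_term_eq f (ht.trans hτ)]; exact h τ hτ

lemma supFn_antitone {n : ℕ} (Φ : ℝ → ℝ) (f : Rn n → ℂ) : Antitone (supFn Φ f) := fun _ _ h =>
  iSup_mono fun _ => iSup_mono' fun hτ => ⟨h.trans_lt hτ, le_rfl⟩

/-! ### Pointwise comparison of (M_Φ f)*, (M_Φ f)** and S_f -/

section Estimates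

variable {n : ℕ} {Φ : ℝ → ℝ} {D : ℝ}

lemma le_dilation (hD : ∀ r R, 0 < r → r ≤ R → Φ r * r ^ n ≤ D * (Φ R * R ^ n))
    {lam r : ℝ} (hlam : 1 ≤ lam) (hr : 0 < r) : Φ r ≤ D * lam ^ n * Φ (lam * r) := by
  have h := hD r (lam * r) hr (le_mul_of_one_le_left hr.le hlam)
  rw [mul_pow] at h
  have hrn : 0 < r ^ n := by positivity
  refine le_of_mul_le_mul_right ?_ hrn
  calc _ ≤ _ := h
    _ = _ := by ring

/-- The supremum in S_f(t) runs over τ > t strictly, whereas rⁿ may equal t and a may exceed rⁿ.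
Dilating the radius by lam > 1 makes τ = (lam r)ⁿ admissible at the cost D lamⁿ. -/
lemma mul_rearrInt_le_supFn (hn : 0 < n) (hD0 : 0 < D)
    (hD : ∀ r R, 0 < r → r ≤ R → Φ r * r ^ n ≤ D * (Φ R * R ^ n)) {lam : ℝ} (hlam : 1 < lam)
    (f : Rn n → ℂ) {t r a : ℝ} (ht : 0 < t) (hr : 0 < r) (htr : t ≤ r ^ n)
    (ha : a ≤ (lam * r) ^ n) :
    ENNReal.ofReal (Φ r) * rearrInt (absFn f) a ≤ ENNReal.ofReal (D * lam ^ n) * supFn Φ f t := by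
  have hlr : 0 < lam * r := by positivity
  have htl : t < (lam * r) ^ n := htr.trans_lt
    (pow_lt_pow_left₀ (lt_mul_of_one_lt_left hr hlam) hr.le hn.ne')
  calc ENNReal.ofReal (Φ r) * rearrInt (absFn f) a
      ≤ ENNReal.ofReal (D * lam ^ n * Φ (lam * r)) * rearrInt (absFn f) ((lam * r) ^ n) :=
        mul_le_mul' (ENNReal.ofReal_le_ofReal (le_dilation hD hlam.le hr))
          (rearrInt_mono _ ha)
    _ = ENNReal.ofReal (D * lam ^ n) * (ENNReal.ofReal (Φ (((lam * r) ^ n) ^ (1 / (n : ℝ))))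
        * rearrInt (absFn f) ((lam * r) ^ n)) := by
        rw [ENNReal.ofReal_mul (by positivity), pow_rpow_one_div hn hlr, mul_assoc]
    _ ≤ _ := by gcongr; exact le_supFn f ht htl

lemma rearr_maximalFn_le_supFn (hn : 0 < n) (hD0 : 0 < D) (hΦ : ClassB n Φ)
    (hD : ∀ r R, 0 < r → r ≤ R → Φ r * r ^ n ≤ D * (Φ R * R ^ n)) :
    ∃ C : ℝ≥0, ∀ f : Rn n → ℂ, AEMeasurable f volume → ∀ t : ℝ, 0 < t →
      rearr (maximalFn Φ f) t ≤ C * supFn Φ f t := by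
  set V := volume (Metric.ball (0 : Rn n) 1) with hV
  set ω := V.toReal with hω
  have hω0 : 0 < ω := volume_unitBall_toReal_pos n
  have hVω : V = ENNReal.ofReal ω := (ENNReal.ofReal_toReal measure_ball_lt_top.ne).symm
  -- Chosen so that lamⁿ ≥ ω, hence |B(x,r)| = ω rⁿ ≤ (lam r)ⁿ.
  set lam : ℝ := 2 + ω with hlam
  have hlam1 : 1 < lam := by linarith
  have hlamn : ω ≤ lam ^ n ∧ 1 ≤ lam ^ n :=
    ⟨(by linarith : ω ≤ lam).trans (le_self_pow₀ hlam1.le hn.ne'), one_le_pow₀ hlam1.le⟩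
  set P := D * lam ^ n with hP
  set Q := 4 ^ n * (D * ω) with hQ
  have hP0 : 0 < P := by positivity
  have hQ0 : 0 < Q := by positivity
  -- The summand P rules out radii above R; 2QP makes QP S ≤ y/2, used for both the low part and the
  -- weak-type bound at level y/2.
  refine ⟨Real.toNNReal (P + 2 * (Q * P)), fun f hf t ht => ?_⟩
  change _ ≤ ENNReal.ofReal (P + 2 * (Q * P)) * _
  set F := absFn f with hF
  set S := supFn Φ f t with hS
  refine rearr_le fun y hy hytop => ?_
  have hPy : ENNReal.ofReal P * S < y := lt_of_le_of_lt (by gcongr; linarith [mul_pos hQ0 hP0]) hy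
  have hQy : ENNReal.ofReal Q * (ENNReal.ofReal P * S) ≤ y / 2 := by
    rw [ENNReal.le_div_iff_mul_le (by simp) (by simp)]
    refine le_trans (le_of_eq_of_le ?_ (b := ENNReal.ofReal (2 * (Q * P)) * S) ?_) hy.le
    · rw [ENNReal.ofReal_mul (p := 2) zero_le_two, ENNReal.ofReal_mul (p := Q) hQ0.le,
        show ENNReal.ofReal 2 = 2 by norm_num]
      ring
    · gcongr; linarith
  have hy0 : y / 2 ≠ 0 := by simpa using (bot_le.trans_lt hy).ne'
  have hyt : y / 2 ≠ ∞ := (ENNReal.div_lt_top hytop.ne (by simp)).ne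
  set R := t ^ (1 / (n : ℝ)) with hR
  have hR0 : 0 < R := by positivity
  have hRn : R ^ n = t := rpow_one_div_pow hn ht
  have hIR : ENNReal.ofReal (Φ R) * rearrInt F t ≤ ENNReal.ofReal P * S :=
    mul_rearrInt_le_supFn hn hD0 hD hlam1 f ht hR0 hRn.ge
      (by rw [mul_pow, hRn]; exact le_mul_of_one_le_left ht.le hlamn.2)
  -- A measurable hull, since f is only a.e. measurable: |E| ≤ t and |f| ≤ f*(t) off E.
  set E := toMeasurable volume {x | rearr F t < F x} with hE
  have hEm : MeasurableSet E := measurableSet_toMeasurable _ _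
  have hEt : volume E ≤ ENNReal.ofReal t := by
    rw [hE, measure_toMeasurable]
    exact distribFn_rearr_le F t
  set ν := (volume.restrict E).withDensity F with hν
  have hνball : ∀ x r, ν (Metric.ball x r) = ∫⁻ z in Metric.ball x r ∩ E, F z := fun x r => by
    rw [hν, withDensity_apply _ measurableSet_ball, Measure.restrict_restrict measurableSet_ball]
  have hνuniv : ν univ ≤ rearrInt F t := by
    rw [hν, withDensity_apply _ MeasurableSet.univ, Measure.restrict_univ]
    exact setLIntegral_absFn_le_rearrInt hf hEt
  have hsub : {x | y < maximalFn Φ f x} ⊆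
      {x | ∃ r, 0 < r ∧ r ≤ R ∧ y / 2 < ENNReal.ofReal (Φ r) * ν (Metric.ball x r)} := by
    intro x hx
    obtain ⟨r, hr0, hr⟩ : ∃ r, 0 < r ∧ y < ENNReal.ofReal (Φ r) * ∫⁻ z in Metric.ball x r, F z := by
      simpa [maximalFn, lt_iSup_iff] using hx
    have hΦr := hΦ.pos r hr0
    have hball : volume (Metric.ball x r) = ENNReal.ofReal (ω * r ^ n) := by
      rw [volume_ball_eq x hr0, ← hV, hVω, ← ENNReal.ofReal_mul (by positivity), mul_comm]
    rcases le_or_gt r R with hrR | hrR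
    · refine ⟨r, hr0, hrR, ?_⟩
      have hout : ∫⁻ z in Metric.ball x r \ E, F z ≤ rearr F t * ENNReal.ofReal (ω * r ^ n) := by
        calc ∫⁻ z in Metric.ball x r \ E, F z ≤ ∫⁻ _ in Metric.ball x r \ E, rearr F t := by
              refine setLIntegral_mono' (measurableSet_ball.diff hEm) fun z hz => ?_
              by_contra! hlt
              exact hz.2 (subset_toMeasurable _ _ hlt)
          _ = rearr F t * volume (Metric.ball x r \ E) := setLIntegral_const _ _
          _ ≤ _ := by
              gcongr
              exact (measure_mono sdiff_subset).trans hball.le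
      have hout2 : ENNReal.ofReal (Φ r) * ∫⁻ z in Metric.ball x r \ E, F z ≤ y / 2 := by
        calc ENNReal.ofReal (Φ r) * ∫⁻ z in Metric.ball x r \ E, F z
            ≤ ENNReal.ofReal (Φ r) * (rearr F t * ENNReal.ofReal (ω * r ^ n)) := by gcongr
          _ = ENNReal.ofReal (ω * (Φ r * r ^ n)) * rearr F t := by
              rw [show ω * (Φ r * r ^ n) = Φ r * (ω * r ^ n) by ring, ENNReal.ofReal_mul hΦr.le]
              ring
          _ ≤ ENNReal.ofReal (Q * (Φ R * t)) * rearr F t := by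
              gcongr ENNReal.ofReal ?_ * _
              have hΦR := hΦ.pos R hR0
              calc ω * (Φ r * r ^ n) ≤ ω * (D * (Φ R * R ^ n)) := by
                    gcongr ω * ?_; exact hD r R hr0 hrR
                _ = 1 * (D * ω) * (Φ R * t) := by rw [hRn]; ring
                _ ≤ _ := by rw [hQ]; gcongr; exact one_le_pow₀ (by norm_num)
          _ = ENNReal.ofReal Q * (ENNReal.ofReal (Φ R) * (ENNReal.ofReal t * rearr F t)) := by
              rw [ENNReal.ofReal_mul hQ0.le, ENNReal.ofReal_mul (hΦ.pos R hR0).le]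
              ring
          _ ≤ ENNReal.ofReal Q * (ENNReal.ofReal (Φ R) * rearrInt F t) := by
              gcongr
              exact mul_rearr_le_rearrInt F t
          _ ≤ ENNReal.ofReal Q * (ENNReal.ofReal P * S) := by gcongr
          _ ≤ _ := hQy
      rw [hνball]
      by_contra! hle
      refine absurd hr (not_lt.2 ?_)
      rw [← lintegral_inter_add_sdiff F (Metric.ball x r) hEm, mul_add]
      exact (add_le_add hle hout2).trans (ENNReal.add_halves y).le
    -- A radius above R gives at most P S < y, by Hardy–Littlewood.
    · exfalso
      refine absurd (hr.trans_le ((mul_le_mul_right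
        (setLIntegral_absFn_le_rearrInt hf hball.le) _).trans ?_)) hPy.not_gt
      refine mul_rearrInt_le_supFn hn hD0 hD hlam1 f ht hr0 ?_ ?_
      · rw [← hRn]
        exact pow_le_pow_left₀ hR0.le hrR.le n
      · rw [mul_pow]
        gcongr
        exact hlamn.1
  refine (measure_mono hsub).trans ((ENNReal.mul_le_mul_iff_right hy0 hyt).1 ?_)
  calc _ ≤ _ := mul_volume_setOf_exists_ball_le hD ν R (y / 2)
    _ ≤ ENNReal.ofReal (4 ^ n * (D * (Φ R * R ^ n))) * V * rearrInt F t := by gcongr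
    _ = ENNReal.ofReal Q * (ENNReal.ofReal (Φ R) * rearrInt F t) * ENNReal.ofReal t := by
        have hΦR := hΦ.pos R hR0
        rw [hVω, ← ENNReal.ofReal_mul (by positivity), hRn,
          show 4 ^ n * (D * (Φ R * t)) * ω = Q * (Φ R * t) by rw [hQ]; ring,
          ENNReal.ofReal_mul hQ0.le, ENNReal.ofReal_mul hΦR.le]
        ring
    _ ≤ ENNReal.ofReal Q * (ENNReal.ofReal P * S) * ENNReal.ofReal t := by gcongr
    _ ≤ _ := by gcongr

/-- For s ≤ t, splitting the supremum at τ = t gives S_f(s) ≤ Φ(s^{1/n}) ∫₀ᵗ f* + S_f(t); the first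
term averages back to a multiple of S_f(t) by B_n(∞). -/
lemma rearrAvg_maximalFn_le_supFn (hn : 0 < n) (hΦ : ClassB n Φ) :
    ∃ C : ℝ≥0, ∀ f : Rn n → ℂ, AEMeasurable f volume → ∀ t : ℝ, 0 < t →
      rearrAvg (maximalFn Φ f) t ≤ C * supFn Φ f t := by
  obtain ⟨D, hD0, hD⟩ := hΦ.exists_mul_pow_le hn
  obtain ⟨C, hC⟩ := rearr_maximalFn_le_supFn hn hD0 hΦ hD
  obtain ⟨A, hA0, hA⟩ := hΦ.exists_lintegral_rpow_le hn
  refine ⟨C * (Real.toNNReal A * Real.toNNReal (D * 2 ^ n) + 1), fun f hf t ht => ?_⟩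
  set S := supFn Φ f t with hS
  set I := rearrInt (absFn f) t with hI
  have ht0 : ENNReal.ofReal t ≠ 0 := by simpa using ht
  have hpt : ∀ s ∈ Ioc 0 t, rearr (maximalFn Φ f) s
      ≤ C * (ENNReal.ofReal (Φ (s ^ (1 / (n : ℝ)))) * I + S) := fun s hs => by
    refine (hC f hf s hs.1).trans ?_
    gcongr
    refine supFn_le hs.1 fun τ hτ => ?_
    rcases le_or_gt τ t with hτt | hτt
    · refine le_add_right (mul_le_mul' (ENNReal.ofReal_le_ofReal ?_) (rearrInt_mono _ hτt))
      have h0s : 0 < s := hs.1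
      have h0τ : 0 < τ := h0s.trans hτ
      exact hΦ.antitone (mem_Ioi.2 (by positivity)) (mem_Ioi.2 (by positivity))
        (Real.rpow_le_rpow h0s.le hτ.le (by positivity))
    · exact le_add_left (le_supFn f ht hτt)
  have hIS : ENNReal.ofReal (Φ (t ^ (1 / (n : ℝ)))) * I ≤ ENNReal.ofReal (D * 2 ^ n) * S := by
    refine mul_rearrInt_le_supFn hn hD0 hD one_lt_two f ht (by positivity)
      (rpow_one_div_pow hn ht).ge ?_
    rw [mul_pow, rpow_one_div_pow hn ht]
    exact le_mul_of_one_le_left ht.le (one_le_pow₀ one_le_two)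
  have hmeas : AEMeasurable (fun s : ℝ => ENNReal.ofReal (Φ (s ^ (1 / (n : ℝ)))))
      (volume.restrict (Ioc 0 t)) := by
    refine AEMeasurable.ennreal_ofReal (ContinuousOn.aemeasurable ?_ measurableSet_Ioc)
    exact hΦ.continuous.comp (Real.continuous_rpow_const (by positivity)).continuousOn
      fun s hs => Real.rpow_pos_of_pos hs.1 _
  calc rearrAvg (maximalFn Φ f) t
      ≤ (ENNReal.ofReal t)⁻¹ * ∫⁻ s in Ioc 0 t,
          C * (ENNReal.ofReal (Φ (s ^ (1 / (n : ℝ)))) * I + S) :=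
        mul_le_mul_right (setLIntegral_mono' measurableSet_Ioc hpt) _
    _ = (ENNReal.ofReal t)⁻¹ * (C * ((∫⁻ s in Ioc 0 t,
          ENNReal.ofReal (Φ (s ^ (1 / (n : ℝ))))) * I + S * ENNReal.ofReal t)) := by
        rw [lintegral_const_mul' _ _ ENNReal.coe_ne_top, lintegral_add_right _ measurable_const,
          setLIntegral_const, Real.volume_Ioc, sub_zero, lintegral_mul_const'' _ hmeas]
    _ ≤ (ENNReal.ofReal t)⁻¹ * (C * (ENNReal.ofReal (A * (t * Φ (t ^ (1 / (n : ℝ))))) * I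
          + S * ENNReal.ofReal t)) := by
        gcongr
        exact hA t ht
    _ = ((ENNReal.ofReal t)⁻¹ * ENNReal.ofReal t) * (C * (ENNReal.ofReal A *
          (ENNReal.ofReal (Φ (t ^ (1 / (n : ℝ)))) * I) + S)) := by
        rw [ENNReal.ofReal_mul hA0.le, ENNReal.ofReal_mul ht.le]
        ring
    _ ≤ C * (ENNReal.ofReal A * (ENNReal.ofReal (D * 2 ^ n) * S) + S) := by
        rw [ENNReal.inv_mul_cancel ht0 ENNReal.ofReal_ne_top, one_mul]
        gcongr
    _ = _ := by
        simp only [ENNReal.coe_mul, ENNReal.coe_add, ENNReal.coe_one]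
        simp only [ENNReal.ofReal]
        ring

lemma supFn_le_rearr_maximalFn (hn : 0 < n) (hΦ : ClassB n Φ) :
    ∃ C : ℝ≥0, ∀ f g : Rn n → ℂ, absFn g =ᵐ[volume] radialRearr (absFn f) → ∀ t : ℝ, 0 < t →
      supFn Φ f t ≤ C * rearr (maximalFn Φ g) t := by
  obtain ⟨D, hD0, hD⟩ := hΦ.exists_mul_pow_le hn
  set ω := (volume (Metric.ball (0 : Rn n) 1)).toReal with hω
  have hω0 : 0 < ω := volume_unitBall_toReal_pos n
  have hVω : volume (Metric.ball (0 : Rn n) 1) = ENNReal.ofReal ω :=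
    (ENNReal.ofReal_toReal measure_ball_lt_top.ne).symm
  -- Ensures 2r ≤ lam τ^{1/n} for the radius r with |B(0,r)| = τ; the 1 gives lam ≥ 1 for
  -- `le_dilation`.
  set lam : ℝ := 1 + 2 * ω⁻¹ ^ (1 / (n : ℝ)) with hlam
  have hlam1 : 1 ≤ lam := by rw [hlam]; linarith [show 0 < ω⁻¹ ^ (1 / (n : ℝ)) by positivity]
  refine ⟨Real.toNNReal (D * lam ^ n), fun f g hg t ht => supFn_le ht fun τ hτ => ?_⟩
  have hτ0 := ht.trans hτ
  set r := (ω⁻¹ * τ) ^ (1 / (n : ℝ)) with hr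
  have hr0 : 0 < r := by positivity
  have hωr : ω * r ^ n = τ := by
    rw [hr, rpow_one_div_pow hn (by positivity), mul_inv_cancel_left₀ hω0.ne']
  have hvol : ENNReal.ofReal t < volume (Metric.ball (0 : Rn n) r) := by
    rw [volume_ball_eq _ hr0, hVω, ← ENNReal.ofReal_mul (by positivity), mul_comm, hωr]
    exact (ENNReal.ofReal_lt_ofReal_iff hτ0).2 hτ
  have hτp : 0 < τ ^ (1 / (n : ℝ)) := by positivity
  have hle : 2 * r ≤ lam * τ ^ (1 / (n : ℝ)) := by
    rw [hr, hlam, Real.mul_rpow (by positivity) hτ0.le]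
    nlinarith
  calc ENNReal.ofReal (Φ (τ ^ (1 / (n : ℝ)))) * rearrInt (absFn f) τ
      ≤ ENNReal.ofReal (D * lam ^ n * Φ (2 * r)) * rearrInt (absFn f) τ := by
        gcongr
        refine (le_dilation hD hlam1 hτp).trans ?_
        gcongr
        exact hΦ.antitone (mem_Ioi.2 (by positivity)) (mem_Ioi.2 (by positivity)) hle
    _ = ENNReal.ofReal (D * lam ^ n) * (ENNReal.ofReal (Φ (2 * r))
          * ∫⁻ x in Metric.ball (0 : Rn n) r, absFn g x) := by
        rw [ENNReal.ofReal_mul (by positivity), mul_assoc,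
          lintegral_congr_ae (ae_restrict_of_ae hg), setLIntegral_radialRearr hn _ hr0, ← hω, hωr]
    _ ≤ _ := mul_le_mul_right (le_rearr_maximalFn Φ g hr0 le_rfl hvol) _

end Estimates

/-! ### Countable subadditivity and finiteness for the norm -/

section FunctionNorm

variable {n : ℕ} {ρ : (Rn n → ℝ≥0∞) → ℝ≥0∞}

lemma IsRINorm.congr (hρ : IsRINorm ρ) {f g : Rn n → ℝ≥0∞} (hf : AEMeasurable f volume)
    (hg : AEMeasurable g volume) (h : f =ᵐ[volume] g) : ρ f = ρ g :=
  le_antisymm (hρ.mono f g hf hg h.le) (hρ.mono g f hg hf h.symm.le)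

lemma IsRINorm.zero (hρ : IsRINorm ρ) : ρ (fun _ => 0) = 0 :=
  (hρ.eq_zero_iff _ aemeasurable_const).2 ae_eq_rfl

lemma IsRINorm.sum_le (hρ : IsRINorm ρ) {f : ℕ → Rn n → ℝ≥0∞}
    (hf : ∀ k, AEMeasurable (f k) volume) (N : ℕ) :
    ρ (fun x => ∑ k ∈ Finset.range N, f k x) ≤ ∑ k ∈ Finset.range N, ρ (f k) := by
  induction N with
  | zero => simp [hρ.zero]
  | succ N ih =>
    simp only [Finset.sum_range_succ]
    exact (hρ.add_le _ _ (Finset.aemeasurable_fun_sum _ fun k _ => hf k) (hf N)).trans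
      (add_le_add_left ih _)

/-- The Fatou property applied to partial sums. -/
lemma IsRINorm.tsum_le (hρ : IsRINorm ρ) {f : ℕ → Rn n → ℝ≥0∞}
    (hf : ∀ k, AEMeasurable (f k) volume) : ρ (fun x => ∑' k, f k x) ≤ ∑' k, ρ (f k) := by
  refine le_of_tendsto' (hρ.fatou (fun N x => ∑ k ∈ Finset.range N, f k x) _
    (fun N => Finset.aemeasurable_fun_sum _ fun k _ => hf k) (AEMeasurable.tsum hf)
    (fun N => .of_forall fun x => ?_) (.of_forall fun x => ENNReal.tendsto_nat_tsum _))
    fun N => (hρ.sum_le hf N).trans (ENNReal.sum_le_tsum _)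
  exact Finset.sum_le_sum_of_subset (Finset.range_mono N.le_succ)

lemma IsRINorm.ae_lt_top (hρ : IsRINorm ρ) {F : Rn n → ℝ≥0∞} (hF : AEMeasurable F volume)
    (hfin : ρ F < ∞) : ∀ᵐ x ∂volume, F x < ∞ := by
  refine ae_of_forall_measure_lt_top_ae_restrict _ fun s hs hst => ?_
  rcases eq_or_ne (volume s) 0 with h0 | h0
  · simp [Measure.restrict_eq_zero.2 h0]
  obtain ⟨c, hc⟩ := hρ.local_integrability s hs (pos_iff_ne_zero.2 h0) hst
  exact ae_lt_top' hF.restrict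
    ((hc F hF).trans_lt (ENNReal.mul_lt_top ENNReal.coe_lt_top hfin)).ne

/-- Every measurable `F ≥ 0` with `ρ F < ∞` is a.e. the modulus of an element of `E`. -/
lemma IsRINorm.exists_absFn_eq (hρ : IsRINorm ρ) {F : Rn n → ℝ≥0∞} (hF : AEMeasurable F volume)
    (hfin : ρ F < ∞) : ∃ g ∈ spaceE ρ, absFn g =ᵐ[volume] F ∧ normE ρ g = ρ F := by
  have hg : AEMeasurable (fun x => ((F x).toReal : ℂ)) volume :=
    Complex.measurable_ofReal.comp_aemeasurable hF.ennreal_toReal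
  have hae : absFn (fun x => ((F x).toReal : ℂ)) =ᵐ[volume] F := by
    filter_upwards [hρ.ae_lt_top hF hfin] with x hx
    rw [absFn, ← ofReal_norm, Complex.norm_real, Real.norm_of_nonneg ENNReal.toReal_nonneg,
      ENNReal.ofReal_toReal hx.ne]
  have hnorm : normE ρ (fun x => ((F x).toReal : ℂ)) = ρ F := hρ.congr hg.enorm hF hae
  exact ⟨_, ⟨hg, hnorm ▸ hfin⟩, hae, hnorm⟩

lemma absFn_const_mul (c : ℝ≥0) (f : Rn n → ℂ) :
    absFn (fun x => ((c : ℝ) : ℂ) * f x) = fun x => c * absFn f x := by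
  ext x
  simp only [absFn, enorm_mul]
  congr 1
  rw [← ofReal_norm, Complex.norm_real, Real.norm_of_nonneg c.coe_nonneg,
    ENNReal.ofReal_coe_nnreal]

lemma normE_const_mul (hρ : IsRINorm ρ) (c : ℝ≥0) {f : Rn n → ℂ} (hf : AEMeasurable f volume) :
    normE ρ (fun x => ((c : ℝ) : ℂ) * f x) = c * normE ρ f := by
  rw [normE, absFn_const_mul]
  exact hρ.smul c _ hf.enorm

lemma const_mul_mem_spaceE (hρ : IsRINorm ρ) (c : ℝ≥0) {f : Rn n → ℂ} (hf : f ∈ spaceE ρ) :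
    (fun x => ((c : ℝ) : ℂ) * f x) ∈ spaceE ρ :=
  ⟨hf.1.const_mul _, by
    rw [normE_const_mul hρ c hf.1]
    exact ENNReal.mul_lt_top ENNReal.coe_lt_top hf.2⟩

end FunctionNorm

/-! ### Cones generated by positive operators -/

section OperatorCones

variable {n : ℕ} {ρ : (Rn n → ℝ≥0∞) → ℝ≥0∞}

/-- The cone of the functions `H f`, `f ∈ E`, with the quotient functional. -/
noncomputable def operatorCone (ρ : (Rn n → ℝ≥0∞) → ℝ≥0∞) (H : (Rn n → ℂ) → RPos → ℝ≥0∞) :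
    FnCone where
  carrier := {h | ∃ f ∈ spaceE ρ, H f = h}
  functional h := ⨅ (f : Rn n → ℂ) (_ : f ∈ spaceE ρ) (_ : H f = h), normE ρ f

/-- Monotone, positively homogeneous operators with strictly positive measurable values. -/
structure IsPositiveOperator (H : (Rn n → ℂ) → RPos → ℝ≥0∞) : Prop where
  mono : ∀ f g, absFn f ≤ᵐ[volume] absFn g → ∀ t, H f t ≤ H g t
  smul : ∀ (c : ℝ≥0) f t, H (fun x => ((c : ℝ) : ℂ) * f x) t = c * H f t
  pos : ∀ f, AEMeasurable f volume → ¬ absFn f =ᵐ[volume] 0 → ∀ t, 0 < H f t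
  measurable : ∀ f, Measurable (H f)

variable {H : (Rn n → ℂ) → RPos → ℝ≥0∞}

lemma operatorCone_functional_le {f : Rn n → ℂ} (hf : f ∈ spaceE ρ) :
    (operatorCone ρ H).functional (H f) ≤ normE ρ f :=
  iInf₂_le_of_le f hf (iInf_le _ rfl)

lemma exists_normE_lt_of_functional_lt {h : RPos → ℝ≥0∞} {a : ℝ≥0∞}
    (ha : (operatorCone ρ H).functional h < a) : ∃ f ∈ spaceE ρ, H f = h ∧ normE ρ f < a := by
  simpa [operatorCone, iInf_lt_iff, and_left_comm] using ha

lemma IsPositiveOperator.eq_zero (hH : IsPositiveOperator H) {f : Rn n → ℂ}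
    (hf : absFn f =ᵐ[volume] 0) : H f = 0 := by
  ext t
  have h1 := hH.mono f (fun x => (((0 : ℝ≥0) : ℝ) : ℂ) * f x)
    (by filter_upwards [hf] with x hx; simp [hx]) t
  rw [hH.smul] at h1
  simpa using h1

/-- If the functional vanishes at a non-zero element of the cone, then the operator is identically
infinite on elements of `E` of arbitrarily small norm. -/
lemma IsPositiveOperator.exists_eq_top (hH : IsPositiveOperator H) (hρ : IsRINorm ρ)
    {f₀ : Rn n → ℂ} (hf₀ : f₀ ∈ spaceE ρ) (hne : ¬ absFn f₀ =ᵐ[volume] 0)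
    (h0 : (operatorCone ρ H).functional (H f₀) = 0) {ε : ℝ≥0∞} (hε : ε ≠ 0) :
    ∃ g ∈ spaceE ρ, normE ρ g < ε ∧ ∀ t, H g t = ∞ := by
  obtain ⟨δ, hδ, hδε⟩ := ENNReal.exists_pos_sum_of_countable (ε := min ε 1)
    (by simp [hε]) ℕ
  have hex : ∀ k : ℕ, ∃ f ∈ spaceE ρ, H f = H f₀ ∧ normE ρ f < (δ k / (k + 1) : ℝ≥0) :=
    -- The multiples (k+1) f_k have summable norms, yet H of their sum dominates (k+1) H f₀ for
    -- every k.
    fun k => exists_normE_lt_of_functional_lt (by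
      rw [h0]
      exact ENNReal.coe_pos.2 (div_pos (hδ k) (by positivity)))
  choose f hfE hfH hfn using hex
  set c : ℕ → ℝ≥0 := fun k => k + 1 with hc
  set F : ℕ → Rn n → ℝ≥0∞ := fun k => absFn fun x => ((c k : ℝ) : ℂ) * f k x with hF
  have hFm : ∀ k, AEMeasurable (F k) volume := fun k => ((hfE k).1.const_mul _).enorm
  have hFρ : ∀ k, ρ (F k) ≤ δ k := fun k => by
    change normE ρ _ ≤ _
    rw [normE_const_mul hρ _ (hfE k).1]
    calc (c k : ℝ≥0∞) * normE ρ (f k) ≤ c k * (δ k / (k + 1) : ℝ≥0) := by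
          gcongr; exact (hfn k).le
      _ = δ k := by
          rw [← ENNReal.coe_mul]
          congr 1
          exact mul_div_cancel₀ _ (by positivity)
  have hsum : ρ (fun x => ∑' k, F k x) < min ε 1 :=
    ((hρ.tsum_le hFm).trans (ENNReal.tsum_le_tsum hFρ)).trans_lt hδε
  obtain ⟨g, hgE, hgF, hgn⟩ := hρ.exists_absFn_eq (AEMeasurable.tsum hFm)
    (hsum.trans_le le_top)
  refine ⟨g, hgE, hgn ▸ hsum.trans_le (min_le_left _ _), fun t => ?_⟩
  by_contra htop
  obtain ⟨k, hk⟩ := ENNReal.exists_nat_mul_gt (hH.pos f₀ hf₀.1 hne t).ne' htop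
  refine absurd hk (not_lt.2 ?_)
  calc (k : ℝ≥0∞) * H f₀ t ≤ (c k : ℝ≥0∞) * H f₀ t := by
        gcongr
        simp [hc]
    _ = H (fun x => ((c k : ℝ) : ℂ) * f k x) t := by rw [hH.smul, hfH]
    _ ≤ H g t := hH.mono _ _ (by
        filter_upwards [hgF] with x hx
        rw [hx]
        exact ENNReal.le_tsum (f := fun k => F k x) k) t

lemma IsPositiveOperator.coveredBy {H₁ H₂ : (Rn n → ℂ) → RPos → ℝ≥0∞}
    (h₁ : IsPositiveOperator H₁) (h₂ : IsPositiveOperator H₂) (hρ : IsRINorm ρ) {C : ℝ≥0}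
    (hC : ∀ f ∈ spaceE ρ, ∃ g ∈ spaceE ρ, normE ρ g ≤ normE ρ f ∧ ∀ t, H₁ f t ≤ C * H₂ g t) :
    (operatorCone ρ H₁).CoveredBy (operatorCone ρ H₂) := by
  have hC' : ∀ f ∈ spaceE ρ, ∃ g ∈ spaceE ρ, normE ρ g ≤ (C + 1 : ℝ≥0) * normE ρ f ∧
      ∀ t, H₁ f t ≤ H₂ g t := fun f hf => by
    obtain ⟨g, hg, hgf, hle⟩ := hC f hf
    refine ⟨_, const_mul_mem_spaceE hρ (C + 1) hg, ?_, fun t => (hle t).trans ?_⟩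
    · rw [normE_const_mul hρ _ hg.1]
      gcongr
    · rw [h₂.smul]
      gcongr
      simp
  -- C + 1 absorbs the pointwise constant by rescaling g; 2 pays for a near-minimizer.
  refine ⟨2 * (C + 1), by positivity, ?_⟩
  rintro _ ⟨f₀, hf₀, rfl⟩
  by_cases h0 : (operatorCone ρ H₁).functional (H₁ f₀) = 0
  · by_cases hne : absFn f₀ =ᵐ[volume] 0
    · obtain ⟨g, hg, hgf, hle⟩ := hC' f₀ hf₀
      refine ⟨H₂ g, ⟨g, hg, rfl⟩, (operatorCone_functional_le hg).trans ?_, hle⟩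
      have : normE ρ f₀ = 0 := (hρ.eq_zero_iff _ hf₀.1.enorm).2 hne
      rw [this, mul_zero] at hgf
      exact hgf.trans bot_le
    -- Degenerate case: the constant ∞ lies in the covering cone with functional zero, so it covers
    -- everything.
    · have hsmall : ∀ ε : ℝ≥0∞, ε ≠ 0 → ∃ g ∈ spaceE ρ, normE ρ g ≤ (C + 1 : ℝ≥0) * ε ∧
          H₂ g = fun _ => ∞ := fun ε hε => by
        obtain ⟨f, hf, hfε, hftop⟩ := h₁.exists_eq_top hρ hf₀ hne h0 hε
        obtain ⟨g, hg, hgf, hle⟩ := hC' f hf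
        exact ⟨g, hg, hgf.trans (by gcongr), funext fun t => top_le_iff.1 ((hftop t).ge.trans (hle t))⟩
      obtain ⟨g, hg, -, hgtop⟩ := hsmall 1 one_ne_zero
      refine ⟨fun _ => ∞, ⟨g, hg, hgtop⟩, ?_, fun t => le_top⟩
      rw [h0, mul_zero]
      refine le_of_forall_gt fun a ha => ?_
      obtain ⟨b, hb0, hba⟩ := exists_between ha
      obtain ⟨g, hg, hgε, hgtop⟩ := hsmall (((C + 1 : ℝ≥0) : ℝ≥0∞)⁻¹ * b)
        (mul_ne_zero (by simp) hb0.ne')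
      rw [← mul_assoc, ENNReal.mul_inv_cancel (by simp) ENNReal.coe_ne_top, one_mul] at hgε
      rw [← hgtop]
      exact ((operatorCone_functional_le hg).trans hgε).trans_lt hba
  · have hfin : (operatorCone ρ H₁).functional (H₁ f₀) ≠ ∞ :=
      ((operatorCone_functional_le hf₀).trans_lt hf₀.2).ne
    have hlt : (operatorCone ρ H₁).functional (H₁ f₀)
        < 2 * (operatorCone ρ H₁).functional (H₁ f₀) := by
      rw [two_mul]
      exact ENNReal.lt_add_right hfin h0
    obtain ⟨f, hf, hfH, hfn⟩ := exists_normE_lt_of_functional_lt hlt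
    obtain ⟨g, hg, hgf, hle⟩ := hC' f hf
    refine ⟨H₂ g, ⟨g, hg, rfl⟩, (operatorCone_functional_le hg).trans (hgf.trans ?_),
      fun t => hfH ▸ hle t⟩
    calc ((C + 1 : ℝ≥0) : ℝ≥0∞) * normE ρ f
        ≤ (C + 1 : ℝ≥0) * (2 * (operatorCone ρ H₁).functional (H₁ f₀)) := by gcongr
      _ = _ := by
          rw [ENNReal.coe_mul]
          simp only [ENNReal.coe_ofNat]
          ring

lemma IsPositiveOperator.functional_const_mul_le (hH : IsPositiveOperator H) (hρ : IsRINorm ρ)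
    {c : ℝ≥0} (hc : c ≠ 0) (h : RPos → ℝ≥0∞) :
    (operatorCone ρ H).functional (fun t => c * h t) ≤ c * (operatorCone ρ H).functional h := by
  have hc0 : (c : ℝ≥0∞) ≠ 0 := by simpa using hc
  rw [mul_comm, ← ENNReal.div_le_iff_le_mul (.inl hc0) (.inl ENNReal.coe_ne_top)]
  refine le_iInf₂ fun f hf => le_iInf fun hfh => ?_
  rw [ENNReal.div_le_iff_le_mul (.inl hc0) (.inl ENNReal.coe_ne_top), mul_comm,
    ← normE_const_mul hρ c hf.1]
  have : (fun t => (c : ℝ≥0∞) * h t) = H (fun x => ((c : ℝ) : ℂ) * f x) := by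
    ext t
    rw [hH.smul, hfh]
  rw [this]
  exact operatorCone_functional_le (const_mul_mem_spaceE hρ c hf)

lemma IsPositiveOperator.isRegular (hH : IsPositiveOperator H) (hρ : IsRINorm ρ)
    (hfin : ∀ f ∈ spaceE ρ, ∀ t, H f t < ∞) : (operatorCone ρ H).IsRegular where
  measurable := by
    rintro _ ⟨f, -, rfl⟩
    exact hH.measurable f
  finite := by
    rintro _ ⟨f, hf, rfl⟩
    exact hfin f hf
  functional_lt_top := by
    rintro _ ⟨f, hf, rfl⟩
    exact (operatorCone_functional_le hf).trans_lt hf.2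
  smul_mem := by
    rintro _ ⟨f, hf, rfl⟩ c
    exact ⟨_, const_mul_mem_spaceE hρ c hf, funext fun t => hH.smul c f t⟩
  functional_smul := by
    rintro _ ⟨f, hf, rfl⟩ c
    rcases eq_or_ne c 0 with rfl | hc
    · have h0 : (fun t => ((0 : ℝ≥0) : ℝ≥0∞) * H f t)
          = H (fun x => (((0 : ℝ≥0) : ℝ) : ℂ) * f x) := funext fun t => (hH.smul 0 f t).symm
      rw [h0]
      refine le_antisymm ((operatorCone_functional_le (const_mul_mem_spaceE hρ 0 hf)).trans ?_)
        (by simp)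
      rw [normE_const_mul hρ 0 hf.1]
      simp
    · refine le_antisymm (hH.functional_const_mul_le hρ hc _) ?_
      have hc0 : (c : ℝ≥0∞) ≠ 0 := by simpa using hc
      have h1 := hH.functional_const_mul_le hρ (inv_ne_zero hc) fun t => c * H f t
      simp only [ENNReal.coe_inv hc, ← mul_assoc,
        ENNReal.inv_mul_cancel hc0 ENNReal.coe_ne_top, one_mul] at h1
      calc (c : ℝ≥0∞) * (operatorCone ρ H).functional (H f)
          ≤ c * ((c : ℝ≥0∞)⁻¹ * (operatorCone ρ H).functional fun t => c * H f t) := by gcongr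
        _ = _ := by rw [← mul_assoc, ENNReal.mul_inv_cancel hc0 ENNReal.coe_ne_top, one_mul]
  eq_zero := by
    rintro _ ⟨f, hf, rfl⟩ h0
    by_cases hne : absFn f =ᵐ[volume] 0
    · rw [hH.eq_zero hne]
    · obtain ⟨g, hg, -, hgtop⟩ := hH.exists_eq_top hρ hf hne h0 one_ne_zero
      exact absurd (hgtop ⟨1, mem_Ioi.2 one_pos⟩) (hfin g hg _).ne

end OperatorCones

/-! ### The three operators and their cones -/

section Operators

variable {n : ℕ} {ρ : (Rn n → ℝ≥0∞) → ℝ≥0∞} {Φ : ℝ → ℝ}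

lemma maximalFn_mono {f g : Rn n → ℂ} (h : absFn f ≤ᵐ[volume] absFn g) (x : Rn n) :
    maximalFn Φ f x ≤ maximalFn Φ g x :=
  iSup₂_mono fun _ _ => mul_le_mul_right (lintegral_mono_ae (ae_restrict_of_ae h)) _

lemma maximalFn_const_mul (c : ℝ≥0) (f : Rn n → ℂ) :
    maximalFn Φ (fun x => ((c : ℝ) : ℂ) * f x) = fun x => c * maximalFn Φ f x := by
  ext x
  simp only [maximalFn, absFn_const_mul, ENNReal.mul_iSup]
  refine iSup_congr fun r => iSup_congr fun _ => ?_
  rw [lintegral_const_mul' _ _ ENNReal.coe_ne_top]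
  ring

lemma exists_setLIntegral_ball_pos {F : Rn n → ℝ≥0∞} (hF : AEMeasurable F volume)
    (h : ¬ F =ᵐ[volume] 0) : ∃ k : ℕ, 0 < ∫⁻ x in Metric.ball (0 : Rn n) k, F x := by
  by_contra! hk
  refine h ?_
  rw [← Measure.restrict_univ (μ := (volume : Measure (Rn n))), ← Metric.iUnion_ball_nat (0 : Rn n)]
  exact (ae_restrict_iUnion_iff _ _).2 fun k =>
    (lintegral_eq_zero_iff' hF.restrict).1 (le_antisymm (hk k) bot_le)

lemma rearr_maximalFn_pos (hn : 0 < n) (hΦ : ClassB n Φ) {f : Rn n → ℂ}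
    (hf : AEMeasurable f volume) (hne : ¬ absFn f =ᵐ[volume] 0) {t : ℝ} (ht : 0 < t) :
    0 < rearr (maximalFn Φ f) t := by
  obtain ⟨k, hk⟩ := exists_setLIntegral_ball_pos hf.enorm hne
  have hω0 := volume_unitBall_toReal_pos n
  set ω := (volume (Metric.ball (0 : Rn n) 1)).toReal with hω
  -- k captures the mass of f, t/ω makes |B(0,r)| exceed t, and 1 gives r ≤ rⁿ and strictness.
  set r := 1 + k + t / ω with hr
  have hr1 : 1 ≤ r := by rw [hr, add_assoc]; exact le_add_of_nonneg_right (by positivity)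
  have hr0 : 0 < r := one_pos.trans_le hr1
  refine lt_of_lt_of_le ?_ (le_rearr_maximalFn Φ f (s := k) hr0 ?_ ?_)
  · exact ENNReal.mul_pos (by simpa using hΦ.pos (2 * r) (by positivity)) hk.ne'
  · rw [hr]
    linarith [show 0 ≤ t / ω by positivity]
  · rw [volume_ball_eq _ hr0, ← ENNReal.ofReal_toReal
      (measure_ball_lt_top (μ := volume) (x := (0 : Rn n)) (r := 1)).ne, ← hω,
      ← ENNReal.ofReal_mul (by positivity)]
    refine (ENNReal.ofReal_lt_ofReal_iff (by positivity)).2 ?_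
    calc t = t / ω * ω := (div_mul_cancel₀ _ hω0.ne').symm
      _ < r * ω := by
          gcongr
          rw [hr]
          linarith [show (0 : ℝ) ≤ k by positivity]
      _ ≤ r ^ n * ω := by gcongr; exact le_self_pow₀ hr1 hn.ne'

lemma rearrInt_pos {F : Rn n → ℝ≥0∞} (hne : ¬ F =ᵐ[volume] 0) {t : ℝ} (ht : 0 < t) :
    0 < rearrInt F t := by
  obtain ⟨y, hy, hdy⟩ : ∃ y : ℝ≥0∞, 0 < y ∧ 0 < distribFn F y := by
    by_contra! hall
    -- At t = 0 this passes from null sets {F > y}, y > 0, to {F > 0}.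
    have h0 := distribFn_rearr_le F 0
    rw [le_antisymm (rearr_le fun y hy _ => (hall y hy).trans bot_le) bot_le] at h0
    refine hne (ae_iff.2 (le_antisymm ?_ bot_le))
    simpa [distribFn, pos_iff_ne_zero] using h0
  obtain ⟨s, hs0, hst, hsd⟩ : ∃ s : ℝ, 0 < s ∧ s ≤ t ∧ ENNReal.ofReal s < distribFn F y := by
    obtain ⟨z, hz0, hz⟩ := exists_between (lt_min hdy (ENNReal.ofReal_pos.2 ht))
    have hzt : z ≠ ∞ := (hz.trans_le le_top).ne
    refine ⟨z.toReal, ENNReal.toReal_pos hz0.ne' hzt, ?_, ?_⟩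
    · exact ENNReal.toReal_le_of_le_ofReal ht.le (hz.le.trans (min_le_right _ _))
    · rw [ENNReal.ofReal_toReal hzt]
      exact hz.trans_le (min_le_left _ _)
  refine lt_of_lt_of_le (ENNReal.mul_pos ?_ ?_)
    ((mul_rearr_le_rearrInt F s).trans (rearrInt_mono F hst))
  · simpa using hs0
  · exact (hy.trans_le (le_rearr_of_lt_distribFn hsd)).ne'

lemma supFn_mono {f g : Rn n → ℂ} (h : absFn f ≤ᵐ[volume] absFn g) (t : ℝ) :
    supFn Φ f t ≤ supFn Φ g t :=
  iSup₂_mono fun _ _ => mul_le_mul_right (rearrAvg_mono_fun (distribFn_mono h) _) _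

lemma supFn_const_mul (c : ℝ≥0) (f : Rn n → ℂ) (t : ℝ) :
    supFn Φ (fun x => ((c : ℝ) : ℂ) * f x) t = c * supFn Φ f t := by
  simp only [supFn, absFn_const_mul, ENNReal.mul_iSup, rearrAvg_const_mul]
  exact iSup_congr fun r => iSup_congr fun _ => by ring

lemma supFn_pos (hΦ : ClassB n Φ) {f : Rn n → ℂ} (hne : ¬ absFn f =ᵐ[volume] 0) {t : ℝ}
    (ht : 0 < t) : 0 < supFn Φ f t := by
  refine lt_of_lt_of_le (ENNReal.mul_pos ?_ (rearrInt_pos hne ?_).ne')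
    (le_supFn f ht (lt_add_one t))
  · simpa using hΦ.pos _ (by positivity)
  · positivity

lemma isPositiveOperator_rearr_maximalFn (hn : 0 < n) (hΦ : ClassB n Φ) :
    IsPositiveOperator fun (f : Rn n → ℂ) (t : RPos) => rearr (maximalFn Φ f) t where
  mono _ _ h _ := rearr_mono_fun (distribFn_mono (.of_forall (maximalFn_mono h))) _
  smul c f t := by rw [maximalFn_const_mul, rearr_const_mul]
  pos _ hf hne t := rearr_maximalFn_pos hn hΦ hf hne t.2
  measurable _ := (rearr_antitone _).measurable.comp measurable_subtype_coe

lemma isPositiveOperator_rearrAvg_maximalFn (hn : 0 < n) (hΦ : ClassB n Φ) :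
    IsPositiveOperator fun (f : Rn n → ℂ) (t : RPos) => rearrAvg (maximalFn Φ f) t where
  mono _ _ h _ := rearrAvg_mono_fun (distribFn_mono (.of_forall (maximalFn_mono h))) _
  smul c f t := by rw [maximalFn_const_mul, rearrAvg_const_mul]
  pos _ hf hne t := (rearr_maximalFn_pos hn hΦ hf hne t.2).trans_le (rearr_le_rearrAvg _ t.2)
  measurable _ := (measurable_rearrAvg _).comp measurable_subtype_coe

lemma isPositiveOperator_supFn (hΦ : ClassB n Φ) :
    IsPositiveOperator fun (f : Rn n → ℂ) (t : RPos) => supFn Φ f t where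
  mono _ _ h t := supFn_mono h t
  smul c f t := supFn_const_mul c f t
  pos _ _ hne t := supFn_pos hΦ hne t.2
  measurable _ := (supFn_antitone Φ _).measurable.comp measurable_subtype_coe

/-- The infimum over u and the inner one over f with M_Φ f = u collapse into one over f. -/
lemma mk_spaceM_eq_operatorCone (N : (Rn n → ℝ≥0∞) → ℝ → ℝ≥0∞) :
    FnCone.mk {h | ∃ u ∈ spaceM ρ Φ, ∀ t : RPos, h t = N u t}
      (fun h => ⨅ (u : Rn n → ℝ≥0∞) (_ : u ∈ spaceM ρ Φ) (_ : ∀ t : RPos, N u t = h t),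
        normM ρ Φ u) = operatorCone ρ fun f t => N (maximalFn Φ f) t := by
  unfold operatorCone
  congr 1
  · ext h
    constructor
    · rintro ⟨_, ⟨f, hf, rfl⟩, hu⟩
      exact ⟨f, hf, funext fun t => (hu t).symm⟩
    · rintro ⟨f, hf, rfl⟩
      exact ⟨_, ⟨f, hf, rfl⟩, fun t => rfl⟩
  · ext h
    refine le_antisymm (le_iInf₂ fun f hf => le_iInf fun hfh => ?_)
      (le_iInf₂ fun u _ => le_iInf fun huh => le_iInf₂ fun f hf => le_iInf fun hfu => ?_)
    · exact iInf₂_le_of_le _ ⟨f, hf, rfl⟩ (iInf_le_of_le (congrFun hfh)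
        (iInf₂_le_of_le f hf (iInf_le _ rfl)))
    · exact iInf₂_le_of_le f hf (iInf_le _ (funext fun t => by rw [← huh t, ← hfu]))

lemma cone1_eq : cone1 ρ Φ = operatorCone ρ fun f t => rearr (maximalFn Φ f) t :=
  mk_spaceM_eq_operatorCone rearr

lemma cone2_eq : cone2 ρ Φ = operatorCone ρ fun f t => rearrAvg (maximalFn Φ f) t :=
  mk_spaceM_eq_operatorCone rearrAvg

lemma cone3_eq : cone3 ρ Φ = operatorCone ρ fun f t => supFn Φ f t := by
  unfold cone3 operatorCone
  simp only [funext_iff, eq_comm]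

end Operators

/-! ### Assembly of the covering relations -/

theorem theorem3p5 {n : ℕ} (hn : 0 < n) (ρ : (Rn n → ℝ≥0∞) → ℝ≥0∞) (hρ : IsRINorm ρ)
    (Φ : ℝ → ℝ) (hΦ : ClassB n Φ) :
    ((cone1 ρ Φ).Equivalent (cone2 ρ Φ) ∧
      (cone2 ρ Φ).Equivalent (cone3 ρ Φ) ∧
      (cone1 ρ Φ).Equivalent (cone3 ρ Φ)) ∧
    ((∀ u ∈ spaceE ρ, ∀ t : ℝ, 0 < t → supFn Φ u t < ∞) →
      (cone1 ρ Φ).IsRegular ∧ (cone2 ρ Φ).IsRegular ∧ (cone3 ρ Φ).IsRegular) := by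
  have hH₁ := isPositiveOperator_rearr_maximalFn hn hΦ
  have hH₂ := isPositiveOperator_rearrAvg_maximalFn hn hΦ
  have hH₃ := isPositiveOperator_supFn (n := n) hΦ
  obtain ⟨C, hC⟩ := rearrAvg_maximalFn_le_supFn hn hΦ
  obtain ⟨C', hC'⟩ := supFn_le_rearr_maximalFn hn hΦ
  -- Rearrangement invariance enters only here: passing to the radial rearrangement does not
  -- increase the norm.
  have hlower : ∀ f ∈ spaceE ρ, ∃ g ∈ spaceE ρ, normE ρ g ≤ normE ρ f ∧
      ∀ t : ℝ, 0 < t → supFn Φ f t ≤ C' * rearr (maximalFn Φ g) t := fun f hf => by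
    have hle : ρ (radialRearr (absFn f)) ≤ normE ρ f :=
      hρ.rearr_mono _ _ (measurable_radialRearr _).aemeasurable hf.1.enorm
        fun t _ => rearr_mono_fun (distribFn_radialRearr_le hn _) t
    obtain ⟨g, hg, hgF, hgn⟩ := hρ.exists_absFn_eq
      (measurable_radialRearr (absFn f)).aemeasurable (hle.trans_lt hf.2)
    exact ⟨g, hg, hgn ▸ hle, hC' f g hgF⟩
  rw [cone1_eq, cone2_eq, cone3_eq]
  have h12 := hH₁.coveredBy hH₂ hρ (C := 1) fun f hf =>
    ⟨f, hf, le_rfl, fun t => by simpa using rearr_le_rearrAvg _ t.2⟩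
  have h23 := hH₂.coveredBy hH₃ hρ (C := C) fun f hf =>
    ⟨f, hf, le_rfl, fun t => hC f hf.1 t t.2⟩
  have h13 := hH₁.coveredBy hH₃ hρ (C := C) fun f hf =>
    ⟨f, hf, le_rfl, fun t => (rearr_le_rearrAvg _ t.2).trans (hC f hf.1 t t.2)⟩
  have h31 := hH₃.coveredBy hH₁ hρ (C := C') fun f hf => by
    obtain ⟨g, hg, hgf, hle⟩ := hlower f hf
    exact ⟨g, hg, hgf, fun t => hle t t.2⟩
  have h32 := hH₃.coveredBy hH₂ hρ (C := C') fun f hf => by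
    obtain ⟨g, hg, hgf, hle⟩ := hlower f hf
    exact ⟨g, hg, hgf, fun t => (hle t t.2).trans
      (mul_le_mul_right (rearr_le_rearrAvg _ t.2) _)⟩
  have h21 := hH₂.coveredBy hH₁ hρ (C := C * C') fun f hf => by
    obtain ⟨g, hg, hgf, hle⟩ := hlower f hf
    refine ⟨g, hg, hgf, fun t => (hC f hf.1 t t.2).trans ?_⟩
    rw [ENNReal.coe_mul, mul_assoc]
    exact mul_le_mul_right (hle t t.2) _
  refine ⟨⟨⟨h12, h21⟩, ⟨h23, h32⟩, ⟨h13, h31⟩⟩, fun hfin => ?_⟩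
  have hfin₂ : ∀ f ∈ spaceE ρ, ∀ t : RPos, rearrAvg (maximalFn Φ f) t < ∞ := fun f hf t =>
    (hC f hf.1 t t.2).trans_lt (ENNReal.mul_lt_top ENNReal.coe_lt_top (hfin f hf t t.2))
  exact ⟨hH₁.isRegular hρ fun f hf t => (rearr_le_rearrAvg _ t.2).trans_lt (hfin₂ f hf t),
    hH₂.isRegular hρ hfin₂, hH₃.isRegular hρ fun f hf t => hfin f hf t t.2⟩
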